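/- Let $n\ge 0$ be an integer, let $x=(x_1,\dots,x_n)$, $y=(y_1,\dots,y_n)$, $q=(q_1,\dots,q_{n-1})$ and $t=(t_w)_{w\in S_n}$ be independent variables, and let $w_0$ be the longest permutation in $S_n$. For $1\le k\le n$ let $\Delta_k(z\,|\,x_1,\dots,x_k)$ be the determinant of the $k\times k$ tridiagonal matrix with diagonal entries $x_1+z,\dots,x_k+z$, entries $q_1,\dots,q_{k-1}$ above the diagonal and entries $-1$ below it, and let $\widetilde e_i$ ($1\le i\le n$) be the coefficient of $z^{n-i}$ in $\Delta_n(z\,|\,x_1,\dots,x_n)$. Let $\widetilde I_n$ be the ideal generated by $\widetilde e_1,\dots,\widetilde e_n$. For $w\in S_n$ the quantum Schubert polynomial is $$\widetilde{\mathfrak S}_w(x)=\partial^{(y)}_{ww_0}\prod_{k=1}^{n-1}\Delta_k(y_{n-k}\,|\,x_1,\dots,x_k)\Big|_{y=0}\in\mathbb Z[x,q],$$ where $\partial^{(y)}_u=\partial_{a_1}\cdots\partial_{a_l}$ for a reduced decomposition $u=s_{a_1}\cdots s_{a_l}$ and $\partial_a f=(f-s_af)/(y_a-y_{a+1})$. Let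 $\mathcal H_n$ be the span of the monomials $x_1^{i_1}\cdots x_n^{i_n}$ with $0\le i_k\le n-k$. Every $f\in\mathbb Q[[x,q,t]]$ is congruent modulo the ideal $\widetilde I_n\,\mathbb Q[[x,q,t]]$ to exactly one element $[f]$ of $\mathcal H_n\otimes\mathbb Q[[q,t]]$, and for all $u,w\in S_n$ there is exactly one family of polynomials $\widetilde c_{uw}^{\,\tau}\in\mathbb Z[q]$, $\tau\in S_n$, with $$\widetilde{\mathfrak S}_u\widetilde{\mathfrak S}_w\equiv\sum_{\tau\in S_n}\widetilde c_{uw}^{\,\tau}\,\widetilde{\mathfrak S}_\tau \pmod{\widetilde I_n}\quad\text{in }\mathbb Z[x,q].$$ Put $$K(x,t)=\Big[\exp\Big(\sum_{w\in S_n}t_w\widetilde{\mathfrak S}_w(x)\Big)\Big],\qquad \widetilde{\mathfrak S}_w^t(x)=\big[K(x,t)\,\widetilde{\mathfrak S}_w(x)\big].$$ Then for all $u,w\in S_n$ $$\frac{\partial}{\partial t_u}\widetilde{\mathfrak S}_w^t(x)=\sum_{\tau\in S_n}\widetilde c_{uw}^{\,\tau}\,\widetilde{\mathfrak S}_\tau^t(x)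 \qquad\text{and}\qquad \Big(\frac{\partial}{\partial t_u}\frac{\partial}{\partial t_w}-\sum_{\tau\in S_n}\widetilde c_{uw}^{\,\tau}\frac{\partial}{\partial t_\tau}\Big)K(x,t)=0 .$$ -/

import Mathlib

namespace QSchubert

open MvPolynomial

/-! ### Adjacent positions and divided differences -/

/-- The position `i` (counted from `0`, with `i + 1 < n`). -/
def lo {n : ℕ} (i : Fin (n - 1)) : Fin n := ⟨i.1, by omega⟩

/-- The position `i + 1`. -/
def hi {n : ℕ} (i : Fin (n - 1)) : Fin n := ⟨i.1 + 1, by omega⟩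

/-- The simple transposition exchanging the positions `i` and `i + 1`. -/
def simple {n : ℕ} (i : Fin (n - 1)) : Equiv.Perm (Fin n) := Equiv.swap (lo i) (hi i)

theorem X_sub_X_dvd {σ R : Type*} [DecidableEq σ] [CommRing R] (i j : σ)
    (f : MvPolynomial σ R) :
    (X i - X j : MvPolynomial σ R) ∣ f - rename (Equiv.swap i j) f := by
  induction f using MvPolynomial.induction_on with
  | C a => simp
  | add p q hp hq =>
    rw [map_add, add_sub_add_comm]
    exact dvd_add hp hq
  | mul_X p k hp =>
    have h : p * X k - rename (Equiv.swap i j) (p * X k)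
        = (p - rename (Equiv.swap i j) p) * X k
          + rename (Equiv.swap i j) p * (X k - X (Equiv.swap i j k)) := by
      rw [map_mul, rename_X]; ring
    rw [h]
    refine dvd_add (hp.mul_right _) (Dvd.dvd.mul_left ?_ _)
    by_cases hki : k = i
    · subst hki; simp
    · by_cases hkj : k = j
      · subst hkj
        rw [Equiv.swap_apply_right, ← neg_sub]
        exact neg_dvd.2 (dvd_refl _)
      · rw [Equiv.swap_apply_of_ne_of_ne hki hkj]; simp

/-- The divided difference `(f - s_i f) / (y_i - y_{i+1})`: the quotient of an exact division
by a non-zero-divisor. -/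
noncomputable def divDiff {n : ℕ} {R : Type*} [CommRing R] (i : Fin (n - 1))
    (f : MvPolynomial (Fin n) R) : MvPolynomial (Fin n) R :=
  (X_sub_X_dvd (lo i) (hi i) f).choose

theorem divDiff_spec {n : ℕ} {R : Type*} [CommRing R] (i : Fin (n - 1))
    (f : MvPolynomial (Fin n) R) :
    f - rename (simple i) f = (X (lo i) - X (hi i)) * divDiff i f :=
  (X_sub_X_dvd (lo i) (hi i) f).choose_spec

/-- Auxiliary quantity that drops when a descent is removed. -/
def weight {n : ℕ} (u : Equiv.Perm (Fin n)) : ℕ := ∑ i : Fin n, (n - i.1) * (u i).1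

theorem weight_lt {n : ℕ} (u : Equiv.Perm (Fin n)) (i : Fin (n - 1))
    (h : u (hi i) < u (lo i)) : weight (u * simple i) < weight u := by
  have hne : lo i ≠ hi i := by
    intro e; rw [e] at h; exact lt_irrefl _ h
  unfold weight
  rw [← Finset.sum_add_sum_compl ({lo i, hi i} : Finset (Fin n)),
    ← Finset.sum_add_sum_compl ({lo i, hi i} : Finset (Fin n)) (fun k => (n - k.1) * (u k).1)]
  have hc : ∀ k ∈ ({lo i, hi i} : Finset (Fin n))ᶜ,
      (n - k.1) * ((u * simple i) k).1 = (n - k.1) * (u k).1 := by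
    intro k hk
    simp only [Finset.mem_compl, Finset.mem_insert, Finset.mem_singleton, not_or] at hk
    rw [Equiv.Perm.mul_apply, simple, Equiv.swap_apply_of_ne_of_ne hk.1 hk.2]
  rw [Finset.sum_congr rfl hc, Finset.sum_pair hne, Finset.sum_pair hne]
  simp only [Equiv.Perm.mul_apply, simple, Equiv.swap_apply_left, Equiv.swap_apply_right]
  have hn : n - (lo i).1 = (n - (hi i).1) + 1 := by
    have := i.2
    simp only [lo, hi]; omega
  rw [hn]
  have h2 : (u (hi i)).1 < (u (lo i)).1 := h
  nlinarith

/-- The divided difference operator `∂_u = ∂_{a_1} ⋯ ∂_{a_l}` of a permutation `u`, where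
`u = s_{a_1} ⋯ s_{a_l}` is a reduced decomposition. The decomposition is produced from its right
end: a descent `i` of `u` gives `∂_u = ∂_{u s_i} ∂_i`. (By the braid relations between the `∂_i`
the result is the same for all reduced decompositions.) -/
noncomputable def divDiffPerm {n : ℕ} {R : Type*} [CommRing R] (u : Equiv.Perm (Fin n))
    (f : MvPolynomial (Fin n) R) : MvPolynomial (Fin n) R :=
  if h : ∃ i : Fin (n - 1), u (hi i) < u (lo i) then
    divDiffPerm (u * simple h.choose) (divDiff h.choose f)
  else f
termination_by weight u
decreasing_by exact weight_lt u _ h.choose_spec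

/-! ### Quantum Schubert polynomials -/

/-- The `k × k` tridiagonal determinant `Δ_k(t | x_1, …, x_k)`: the diagonal is
`x_1 + t, …, x_k + t`, above it stand `q_1, …, q_{k-1}` and below it `-1, …, -1`.
The sequences are counted from `0`, so `x j` stands for `x_{j+1}` and `q j` for `q_{j+1}`. -/
def qDelta {R : Type*} [CommRing R] (x q : ℕ → R) (k : ℕ) (t : R) : R :=
  Matrix.det (Matrix.of fun i j : Fin k =>
    if i = j then x i + t
    else if i.1 + 1 = j.1 then q i
    else if j.1 + 1 = i.1 then -1
    else 0)

/-- The ring `ℤ[x_1, …, x_n, q_1, …, q_{n-1}]`. -/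
abbrev XQ (n : ℕ) : Type := MvPolynomial (Fin n ⊕ Fin (n - 1)) ℤ

/-- The variable `x_{j+1}` of `ℤ[x, q]`, for `j < n`. -/
noncomputable def xVar (n : ℕ) (j : ℕ) : XQ n := if h : j < n then X (Sum.inl ⟨j, h⟩) else 0

/-- The variable `q_{j+1}` of `ℤ[x, q]`, for `j < n - 1`. -/
noncomputable def qVar (n : ℕ) (j : ℕ) : XQ n :=
  if h : j < n - 1 then X (Sum.inr ⟨j, h⟩) else 0

/-- The quantum elementary polynomial `e_i(x_1, …, x_k | q_1, …, q_{k-1})`: the coefficient of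
`t^{k-i}` in `Δ_k(t | x_1, …, x_k)`. -/
noncomputable def qElem (n k i : ℕ) : XQ n :=
  (qDelta (fun j => Polynomial.C (xVar n j)) (fun j => Polynomial.C (qVar n j)) k
    Polynomial.X).coeff (k - i)

/-- The ideal of `ℤ[x, q]` generated by `e_i(x_1, …, x_n | q_1, …, q_{n-1})`, `1 ≤ i ≤ n`. -/
noncomputable def qIdeal (n : ℕ) : Ideal (XQ n) :=
  Ideal.span {e | ∃ i : ℕ, 1 ≤ i ∧ i ≤ n ∧ e = qElem n n i}

/-- The top quantum double Schubert polynomial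
`∏_{k=1}^{n-1} Δ_k(y_{n-k} | x_1, …, x_k)`, as a polynomial in `y_1, …, y_n` over `ℤ[x, q]`.
The factor of index `i` is the one with `k = i + 1`. -/
noncomputable def qDoubleTop (n : ℕ) : MvPolynomial (Fin n) (XQ n) :=
  ∏ i : Fin (n - 1),
    qDelta (fun j => C (xVar n j)) (fun j => C (qVar n j)) (i.1 + 1)
      (X (⟨n - 2 - i.1, by omega⟩ : Fin n))

/-- The quantum double Schubert polynomial of `w`, namely `∂_{w w_0}` applied in the variables `y`
to the top one; here `w_0` is the longest permutation, `Fin.revPerm`. -/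
noncomputable def qDouble {n : ℕ} (w : Equiv.Perm (Fin n)) : MvPolynomial (Fin n) (XQ n) :=
  divDiffPerm (w * Fin.revPerm) (qDoubleTop n)

/-- The quantum Schubert polynomial of `w`: the specialization `y = 0`. -/
noncomputable def qSchubert {n : ℕ} (w : Equiv.Perm (Fin n)) : XQ n :=
  eval (fun _ => 0) (qDouble w)

/-- `c` is the family of coefficients `c_{uw}^τ ∈ ℤ[q]` in
`S_u S_w ≡ ∑_τ c_{uw}^τ S_τ` modulo the ideal of quantum elementary polynomials. -/
def IsStructConst {n : ℕ} (u w : Equiv.Perm (Fin n))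
    (c : Equiv.Perm (Fin n) → MvPolynomial (Fin (n - 1)) ℤ) : Prop :=
  qSchubert u * qSchubert w - ∑ τ, rename Sum.inr (c τ) * qSchubert τ ∈ qIdeal n

/-- The structure constants `c_{uw}^τ ∈ ℤ[q]` of quantum Schubert polynomials. -/
noncomputable def structConst {n : ℕ} (u w τ : Equiv.Perm (Fin n)) :
    MvPolynomial (Fin (n - 1)) ℤ :=
  Classical.epsilon (IsStructConst u w) τ

/-! ### Power series, the projection and the `t`-deformation -/

/-- The index set of the variables `x_1, …, x_n`, `q_1, …, q_{n-1}` and `t_w`, `w ∈ S_n`. -/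
abbrev Vars (n : ℕ) : Type := (Fin n ⊕ Fin (n - 1)) ⊕ Equiv.Perm (Fin n)

/-- The formal power series ring `ℚ[[x, q, t]]`. -/
abbrev PS (n : ℕ) : Type := MvPowerSeries (Vars n) ℚ

/-- The inclusion of `ℤ[x, q]` into `ℚ[[x, q, t]]`. -/
noncomputable def ofXQ (n : ℕ) : XQ n →ₐ[ℤ] PS n :=
  aeval fun s => MvPowerSeries.X (Sum.inl s)

/-- The inclusion of `ℤ[q]` into `ℚ[[x, q, t]]`. -/
noncomputable def ofQ (n : ℕ) : MvPolynomial (Fin (n - 1)) ℤ →ₐ[ℤ] PS n :=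
  aeval fun i => MvPowerSeries.X (Sum.inl (Sum.inr i))

/-- The ideal of `ℚ[[x, q, t]]` generated by the quantum elementary polynomials
`e_i(x_1, …, x_n | q)`, `1 ≤ i ≤ n`. -/
noncomputable def qIdealPS (n : ℕ) : Ideal (PS n) := (qIdeal n).map (ofXQ n)

/-- `f` belongs to `H_n ⊗ ℚ[[q, t]]`, where `H_n` is spanned by the monomials
`x_1^{i_1} ⋯ x_n^{i_n}` with `i_k ≤ n - k`: only such monomials in `x` occur in `f`.
(The index `j` is `k - 1`.) -/
def InStaircase {n : ℕ} (f : PS n) : Prop :=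
  ∀ m : Vars n →₀ ℕ, MvPowerSeries.coeff m f ≠ 0 →
    ∀ j : Fin n, m (Sum.inl (Sum.inl j)) ≤ n - 1 - j.1

/-- `g` is the projection of `f` to `H_n ⊗ ℚ[[q, t]]` along the ideal of quantum elementary
polynomials. -/
def IsProj {n : ℕ} (f g : PS n) : Prop := InStaircase g ∧ f - g ∈ qIdealPS n

/-- The projection `[f]` of `f` to `H_n ⊗ ℚ[[q, t]]`. -/
noncomputable def proj {n : ℕ} (f : PS n) : PS n := Classical.epsilon (IsProj f)

/-- The exponent `∑_w t_w S_w(x)`. -/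
noncomputable def exponent (n : ℕ) : PS n :=
  ∑ w : Equiv.Perm (Fin n), MvPowerSeries.X (Sum.inr w) * ofXQ n (qSchubert w)

/-- The exponent has no constant term, so its exponential is a formal power series. -/
theorem hasSubst_exponent (n : ℕ) : PowerSeries.HasSubst (exponent n) :=
  PowerSeries.HasSubst.of_constantCoeff_zero (by simp [exponent])

/-- The kernel `K(x, t) = [exp (∑_w t_w S_w(x))]`. -/
noncomputable def kernel (n : ℕ) : PS n := proj ((PowerSeries.exp ℚ).subst (exponent n))

/-- The `t`-deformed quantum Schubert polynomial `S_w^t = [K(x, t) S_w(x)]`. -/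
noncomputable def tSchubert {n : ℕ} (w : Equiv.Perm (Fin n)) : PS n :=
  proj (kernel n * ofXQ n (qSchubert w))

/-- The partial derivative with respect to `t_w`. -/
noncomputable def dt {n : ℕ} (w : Equiv.Perm (Fin n)) (f : PS n) : PS n :=
  MvPowerSeries.pderiv ℚ (Sum.inr w) f

end QSchubert

/-! Write E for `expSchubert n`, the exponential before projection, so that ∂E/∂t_u = S_u E. The
projection [·] is ℤ[q]-linear and commutes with ∂/∂t_u, because the generators e_i involve no t and
the staircase condition restricts only the exponents of x. Moreover [[f] g] = [f g]. Hence S_w^t =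
[E S_w] = ∂K/∂t_w (`tSchubert_eq`, `dt_kernel`) and ∂S_w^t/∂t_u = [E S_u S_w] = ∑ c_{uw}^τ [E S_τ],
the first equation; the second is the same equation with S^t written as a derivative of K.

The substance is that [·] and the c_{uw}^τ exist and are unique. Both come from a basis: over a
domain R and for any scalars q in R, the products of a staircase monomial with a monomial in the
quantum e_i(x_1, …, x_n) form an R-basis of R[x] (`span_stairFamily`,
`linearIndependent_stairFamily`). With q counted in degree 0, the leading form of a quantum e_i is
the classical one, so q = 0 suffices. There, spanning follows by adjoining the variables one at a
time. Independence follows from divided differences: they are linear over symmetric polynomials, and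
their integral combinations, evaluated at 0, extract each staircase coefficient
(`exists_coeff_eq_sum_divDiffPerm`). The ideal is spanned by the basis elements with a nontrivial
e-part, so the staircase monomials are a basis of the quotient (`exists_stair_sub_mem`,
`stair_eq_zero_of_mem`).

The same extraction, in the variables y, shows that the coefficients of the top double polynomial,
the products ∏ e_{p_k}(x_1, …, x_k), are integral combinations of the S_w. These products span the
quotient, and there are n! of the S_w, as many as staircase monomials; so the S_w are a basis over
ℤ[q].

For power series, x and t get degree 1 and q degree 2. Each e_i is then homogeneous and each degree
has finitely many monomials, so the polynomial statements apply degree by degree (`exists_isProj`,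
`eq_zero_of_inStaircase`). -/

namespace QSchubert

open MvPolynomial

/-! ### Divided differences and their braid relations -/

section DividedDifferences

variable {n : ℕ} {R : Type*} [CommRing R]

theorem lo_ne_hi (i : Fin (n - 1)) : lo i ≠ hi i := by
  intro e
  have := congrArg Fin.val e
  simp [lo, hi] at this

theorem simple_lo (i : Fin (n - 1)) : simple i (lo i) = hi i := Equiv.swap_apply_left _ _

theorem simple_hi (i : Fin (n - 1)) : simple i (hi i) = lo i := Equiv.swap_apply_right _ _

theorem simple_of_ne (i : Fin (n - 1)) {k : Fin n} (h1 : k ≠ lo i) (h2 : k ≠ hi i) :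
    simple i k = k := Equiv.swap_apply_of_ne_of_ne h1 h2

theorem simple_simple (i : Fin (n - 1)) (k : Fin n) : simple i (simple i k) = k :=
  Equiv.swap_apply_self _ _ _

theorem rename_simple_rename_simple (i : Fin (n - 1)) (f : MvPolynomial (Fin n) R) :
    rename (simple i) (rename (simple i) f) = f := by
  rw [rename_rename]
  have : (simple i : Fin n → Fin n) ∘ simple i = id := funext (simple_simple i)
  rw [this, rename_id_apply]

theorem X_lo_sub_X_hi_ne_zero [IsDomain R] (i : Fin (n - 1)) :
    (X (lo i) - X (hi i) : MvPolynomial (Fin n) R) ≠ 0 :=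
  sub_ne_zero.2 fun h => lo_ne_hi i (X_injective h)

/-- Over a domain the quotient is unique, so the choice in `divDiff` is harmless: an identity for
`divDiff` is proved by exhibiting a quotient. -/
theorem divDiff_eq [IsDomain R] {i : Fin (n - 1)} {f g : MvPolynomial (Fin n) R}
    (h : f - rename (simple i) f = (X (lo i) - X (hi i)) * g) : divDiff i f = g :=
  mul_left_cancel₀ (X_lo_sub_X_hi_ne_zero i) ((divDiff_spec i f).symm.trans h)

theorem divDiff_map {S : Type*} [CommRing S] [IsDomain S] (φ : R →+* S) (i : Fin (n - 1))
    (f : MvPolynomial (Fin n) R) : divDiff i (map φ f) = map φ (divDiff i f) := by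
  apply divDiff_eq
  have h := congrArg (map φ) (divDiff_spec i f)
  rw [map_sub, map_mul, map_sub, map_X, map_X, map_rename] at h
  exact h

variable [IsDomain R]

theorem divDiff_add (i : Fin (n - 1)) (f g : MvPolynomial (Fin n) R) :
    divDiff i (f + g) = divDiff i f + divDiff i g := by
  apply divDiff_eq
  rw [mul_add, ← divDiff_spec, ← divDiff_spec, map_add]
  ring

theorem divDiff_mul (i : Fin (n - 1)) (f g : MvPolynomial (Fin n) R) :
    divDiff i (f * g) = divDiff i f * g + rename (simple i) f * divDiff i g := by
  apply divDiff_eq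
  rw [map_mul]
  linear_combination g * divDiff_spec i f + rename (simple i) f * divDiff_spec i g

theorem divDiff_of_symm {i : Fin (n - 1)} {f : MvPolynomial (Fin n) R}
    (h : rename (simple i) f = f) : divDiff i f = 0 := by
  apply divDiff_eq
  rw [h, sub_self, mul_zero]

theorem divDiff_symm_mul {i : Fin (n - 1)} {f : MvPolynomial (Fin n) R}
    (h : rename (simple i) f = f) (g : MvPolynomial (Fin n) R) :
    divDiff i (f * g) = f * divDiff i g := by
  rw [divDiff_mul, divDiff_of_symm h, h, zero_mul, zero_add]

theorem divDiff_smul (i : Fin (n - 1)) (c : R) (f : MvPolynomial (Fin n) R) :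
    divDiff i (c • f) = c • divDiff i f := by
  rw [smul_eq_C_mul, smul_eq_C_mul, divDiff_symm_mul (rename_C _ _)]

/-- Numerator and denominator both change sign under s_i. -/
theorem rename_divDiff (i : Fin (n - 1)) (f : MvPolynomial (Fin n) R) :
    rename (simple i) (divDiff i f) = divDiff i f := by
  symm
  apply divDiff_eq
  have h := congrArg (rename (simple i)) (divDiff_spec i f)
  rw [map_sub, map_mul, map_sub, rename_X, rename_X, simple_lo, simple_hi,
    rename_simple_rename_simple] at h
  linear_combination -h

theorem divDiff_divDiff (i : Fin (n - 1)) (f : MvPolynomial (Fin n) R) :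
    divDiff i (divDiff i f) = 0 := divDiff_of_symm (rename_divDiff i f)

/-- The divided difference as a linear map. -/
noncomputable def divDiffLin (R : Type*) [CommRing R] [IsDomain R] (i : Fin (n - 1)) :
    MvPolynomial (Fin n) R →ₗ[R] MvPolynomial (Fin n) R where
  toFun := divDiff i
  map_add' := divDiff_add i
  map_smul' := divDiff_smul i

/-- Clearing both denominators leaves f - s_i f - s_j f + s_i s_j f on either side. -/
theorem divDiff_comm {i j : Fin (n - 1)} (hij : i.1 + 1 < j.1) (f : MvPolynomial (Fin n) R) :
    divDiff i (divDiff j f) = divDiff j (divDiff i f) := by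
  have h1 : lo j ≠ lo i := by simp only [lo, ne_eq, Fin.mk.injEq]; omega
  have h2 : lo j ≠ hi i := by simp only [lo, hi, ne_eq, Fin.mk.injEq]; omega
  have h3 : hi j ≠ lo i := by simp only [lo, hi, ne_eq, Fin.mk.injEq]; omega
  have h4 : hi j ≠ hi i := by simp only [hi, ne_eq, Fin.mk.injEq]; omega
  have hc : rename (simple i) (rename (simple j) f) = rename (simple j) (rename (simple i) f) := by
    rw [rename_rename, rename_rename]
    congr 1
    have : Commute (simple i) (simple j) :=
      Equiv.Perm.Disjoint.commute (by
        intro x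
        by_cases hx : x = lo i ∨ x = hi i
        · right
          rcases hx with rfl | rfl
          · exact simple_of_ne j h1.symm h3.symm
          · exact simple_of_ne j h2.symm h4.symm
        · rw [not_or] at hx
          exact Or.inl (simple_of_ne i hx.1 hx.2))
    congr 1
    funext x
    exact DFunLike.congr_fun this.eq x
  apply mul_left_cancel₀ (mul_ne_zero (X_lo_sub_X_hi_ne_zero (R := R) i)
    (X_lo_sub_X_hi_ne_zero (R := R) j))
  have e1 := divDiff_spec i (divDiff j f)
  have e2 := divDiff_spec j f
  have e3 := congrArg (rename (simple i)) (divDiff_spec j f)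
  have e4 := divDiff_spec j (divDiff i f)
  have e5 := divDiff_spec i f
  have e6 := congrArg (rename (simple j)) (divDiff_spec i f)
  rw [map_sub, map_mul, map_sub, rename_X, rename_X, simple_of_ne i h1 h2,
    simple_of_ne i h3 h4] at e3
  rw [map_sub, map_mul, map_sub, rename_X, rename_X, simple_of_ne j h1.symm h3.symm,
    simple_of_ne j h2.symm h4.symm] at e6
  rw [hc] at e3
  linear_combination -(X (lo j) - X (hi j)) * e1 - e2 + e3 + (X (lo i) - X (hi i)) * e4
    + e5 - e6

/-- Multiplied by the Vandermonde product of the three variables involved, both sides become the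
alternating sum of f over the six permutations generated by s_i and s_j. -/
theorem divDiff_braid {i j : Fin (n - 1)} (hij : i.1 + 1 = j.1) (f : MvPolynomial (Fin n) R) :
    divDiff i (divDiff j (divDiff i f)) = divDiff j (divDiff i (divDiff j f)) := by
  have hb : lo j = hi i := by simp only [lo, hi, Fin.mk.injEq]; omega
  have hca : hi j ≠ lo i := by simp only [lo, hi, ne_eq, Fin.mk.injEq]; omega
  have hcb : hi j ≠ hi i := hb ▸ (lo_ne_hi j).symm
  have hab : lo i ≠ hi i := lo_ne_hi i
  have hsc : simple i (hi j) = hi j := simple_of_ne i hca hcb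
  have hta : simple j (lo i) = lo i := simple_of_ne j (hb ▸ hab) hca.symm
  have htb : simple j (hi i) = hi j := hb ▸ simple_lo j
  have htc : simple j (hi j) = hi i := hb ▸ simple_hi j
  have hbr : rename (simple i) (rename (simple j) (rename (simple i) f)) =
      rename (simple j) (rename (simple i) (rename (simple j) f)) := by
    simp only [rename_rename]
    congr 1
    have h1 : simple i * simple j * simple i = simple j * simple i * simple j := by
      simp only [simple, hb]
      rw [Equiv.swap_comm (lo i) (hi i), Equiv.swap_comm (hi i) (hi j),
        Equiv.swap_mul_swap_mul_swap hcb hca, Equiv.swap_comm (hi j) (hi i),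
        Equiv.swap_comm (hi i) (lo i),
        Equiv.swap_mul_swap_mul_swap hab hca.symm, Equiv.swap_comm]
    congr 1
    funext x
    exact DFunLike.congr_fun h1 x
  have hac : (X (lo i) - X (hi j) : MvPolynomial (Fin n) R) ≠ 0 :=
    sub_ne_zero.2 fun h => hca (X_injective h).symm
  apply mul_left_cancel₀ (mul_ne_zero (mul_ne_zero (X_lo_sub_X_hi_ne_zero (R := R) i)
    (X_lo_sub_X_hi_ne_zero (R := R) j)) hac)
  have a1 := divDiff_spec i f
  have a2 := congrArg (rename (simple j)) a1
  have a3 := congrArg (rename (simple i)) a2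
  have a4 := divDiff_spec j (divDiff i f)
  have a5 := congrArg (rename (simple i)) a4
  have a6 := divDiff_spec i (divDiff j (divDiff i f))
  have b1 := divDiff_spec j f
  have b2 := congrArg (rename (simple i)) b1
  have b3 := congrArg (rename (simple j)) b2
  have b4 := divDiff_spec i (divDiff j f)
  have b5 := congrArg (rename (simple j)) b4
  have b6 := divDiff_spec j (divDiff i (divDiff j f))
  simp only [map_sub, map_mul, rename_X, simple_lo, simple_hi, hb, hsc, hta, htb, htc,
    rename_divDiff] at a1 a2 a3 a4 a5 a6 b1 b2 b3 b4 b5 b6 ⊢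
  rw [hbr] at a3
  generalize rename (simple i) (rename (simple j) (divDiff i f)) = A3 at *
  generalize rename (simple j) (rename (simple i) (divDiff j f)) = B3 at *
  linear_combination
    -(X (lo i) - X (hi j)) * (X (hi i) - X (hi j)) * a6
    - (X (lo i) - X (hi j)) * a4 + (X (hi i) - X (hi j)) * a5 - a1 + a2 - a3
    + (X (lo i) - X (hi j)) * (X (lo i) - X (hi i)) * b6
    + (X (lo i) - X (hi j)) * b4 - (X (lo i) - X (hi i)) * b5 + b1 - b2 + b3

end DividedDifferences

/-! ### The operators ∂_u and the nil-Coxeter algebra -/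

section PermutationOperators

variable {n : ℕ} {R : Type*} [CommRing R]

theorem divDiffPerm_of_no_descent {u : Equiv.Perm (Fin n)}
    (h : ¬ ∃ i : Fin (n - 1), u (hi i) < u (lo i)) (f : MvPolynomial (Fin n) R) :
    divDiffPerm u f = f := by
  rw [divDiffPerm, dif_neg h]

theorem divDiffPerm_one (f : MvPolynomial (Fin n) R) : divDiffPerm 1 f = f := by
  apply divDiffPerm_of_no_descent
  rintro ⟨i, h⟩
  rw [Equiv.Perm.one_apply, Equiv.Perm.one_apply, Fin.lt_def] at h
  simp [lo, hi] at h

/-- The descent chosen by the definition depends on u alone, so one i serves all rings and all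
polynomials. -/
theorem exists_divDiffPerm_step {u : Equiv.Perm (Fin n)}
    (h : ∃ i : Fin (n - 1), u (hi i) < u (lo i)) :
    ∃ i : Fin (n - 1), u (hi i) < u (lo i) ∧ ∀ (S : Type*) [CommRing S]
      (f : MvPolynomial (Fin n) S), divDiffPerm u f = divDiffPerm (u * simple i) (divDiff i f) := by
  refine ⟨h.choose, h.choose_spec, fun S _ f => ?_⟩
  rw [divDiffPerm, dif_pos h]

variable [IsDomain R]

/-- With descents at i and i + 1, u decreases on three consecutive positions. Both routes can then
be continued, by the induction hypothesis, to u s_i s_j s_i = u s_j s_i s_j, where the braid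
relation compares them. -/
theorem divDiffPerm_step_adjacent {u : Equiv.Perm (Fin n)}
    (ih : ∀ v : Equiv.Perm (Fin n), weight v < weight u → ∀ i : Fin (n - 1), v (hi i) < v (lo i) →
      ∀ f : MvPolynomial (Fin n) R, divDiffPerm v f = divDiffPerm (v * simple i) (divDiff i f))
    {i j : Fin (n - 1)} (hij : i.1 + 1 = j.1) (hi' : u (hi i) < u (lo i))
    (hj : u (hi j) < u (lo j)) (f : MvPolynomial (Fin n) R) :
    divDiffPerm (u * simple i) (divDiff i f) = divDiffPerm (u * simple j) (divDiff j f) := by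
  have hb : lo j = hi i := by simp only [lo, hi, Fin.mk.injEq]; omega
  have hca : hi j ≠ lo i := by simp only [lo, hi, ne_eq, Fin.mk.injEq]; omega
  have hcb : hi j ≠ hi i := hb ▸ (lo_ne_hi j).symm
  have hab : lo i ≠ hi i := lo_ne_hi i
  have hsc : simple i (hi j) = hi j := simple_of_ne i hca hcb
  have hta : simple j (lo i) = lo i := simple_of_ne j (hb ▸ hab) hca.symm
  have htb : simple j (hi i) = hi j := hb ▸ simple_lo j
  have htc : simple j (hi j) = hi i := hb ▸ simple_hi j
  rw [hb] at hj
  have w1 := weight_lt u i hi'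
  have w2 := weight_lt u j (by rw [hb]; exact hj)
  have d1 : (u * simple i) (hi j) < (u * simple i) (lo j) := by
    rw [hb, Equiv.Perm.mul_apply, Equiv.Perm.mul_apply, hsc, simple_hi]
    exact hj.trans hi'
  have d2 : (u * simple i * simple j) (hi i) < (u * simple i * simple j) (lo i) := by
    simp only [Equiv.Perm.mul_apply, htb, hta, hsc, simple_lo]
    exact hj
  have d3 : (u * simple j) (hi i) < (u * simple j) (lo i) := by
    rw [Equiv.Perm.mul_apply, Equiv.Perm.mul_apply, htb, hta]
    exact hj.trans hi'
  have d4 : (u * simple j * simple i) (hi j) < (u * simple j * simple i) (lo j) := by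
    simp only [Equiv.Perm.mul_apply, hb, hta, hsc, simple_hi, htc]
    exact hi'
  have hbr : simple i * simple j * simple i = simple j * simple i * simple j := by
    simp only [simple, hb]
    rw [Equiv.swap_comm (lo i) (hi i), Equiv.swap_comm (hi i) (hi j),
      Equiv.swap_mul_swap_mul_swap hcb hca, Equiv.swap_comm (hi j) (hi i),
      Equiv.swap_comm (hi i) (lo i),
      Equiv.swap_mul_swap_mul_swap hab hca.symm, Equiv.swap_comm]
  rw [ih _ w1 j d1, ih _ ((weight_lt _ j d1).trans w1) i d2, ih _ w2 i d3,
    ih _ ((weight_lt _ i d3).trans w2) j d4, divDiff_braid hij]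
  congr 1
  simpa only [mul_assoc] using congrArg (u * ·) hbr

theorem divDiffPerm_step_far {u : Equiv.Perm (Fin n)}
    (ih : ∀ v : Equiv.Perm (Fin n), weight v < weight u → ∀ i : Fin (n - 1), v (hi i) < v (lo i) →
      ∀ f : MvPolynomial (Fin n) R, divDiffPerm v f = divDiffPerm (v * simple i) (divDiff i f))
    {i j : Fin (n - 1)} (hij : i.1 + 1 < j.1) (hi' : u (hi i) < u (lo i))
    (hj : u (hi j) < u (lo j)) (f : MvPolynomial (Fin n) R) :
    divDiffPerm (u * simple i) (divDiff i f) = divDiffPerm (u * simple j) (divDiff j f) := by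
  have h1 : lo j ≠ lo i := by simp only [lo, ne_eq, Fin.mk.injEq]; omega
  have h2 : lo j ≠ hi i := by simp only [lo, hi, ne_eq, Fin.mk.injEq]; omega
  have h3 : hi j ≠ lo i := by simp only [lo, hi, ne_eq, Fin.mk.injEq]; omega
  have h4 : hi j ≠ hi i := by simp only [hi, ne_eq, Fin.mk.injEq]; omega
  have hc : Commute (simple i) (simple j) :=
    Equiv.Perm.Disjoint.commute (by
      intro x
      by_cases hx : x = lo i ∨ x = hi i
      · right
        rcases hx with rfl | rfl
        · exact simple_of_ne j h1.symm h3.symm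
        · exact simple_of_ne j h2.symm h4.symm
      · rw [not_or] at hx
        exact Or.inl (simple_of_ne i hx.1 hx.2))
  have d1 : (u * simple i) (hi j) < (u * simple i) (lo j) := by
    rwa [Equiv.Perm.mul_apply, Equiv.Perm.mul_apply, simple_of_ne i h3 h4, simple_of_ne i h1 h2]
  have d2 : (u * simple j) (hi i) < (u * simple j) (lo i) := by
    rwa [Equiv.Perm.mul_apply, Equiv.Perm.mul_apply, simple_of_ne j h1.symm h3.symm,
      simple_of_ne j h2.symm h4.symm]
  rw [ih _ (weight_lt u i hi') j d1, ih _ (weight_lt u j hj) i d2, divDiff_comm hij,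
    mul_assoc, mul_assoc, hc.eq]

/-- A descent of `u` may be split off from `∂_u`: the operator `∂_u` does not depend on the
reduced decomposition. -/
theorem divDiffPerm_of_descent (u : Equiv.Perm (Fin n)) {i : Fin (n - 1)}
    (h : u (hi i) < u (lo i)) (f : MvPolynomial (Fin n) R) :
    divDiffPerm u f = divDiffPerm (u * simple i) (divDiff i f) := by
  induction hw : weight u using Nat.strong_induction_on generalizing u i f with
  | _ N ih =>
    subst hw
    have ih' : ∀ v : Equiv.Perm (Fin n), weight v < weight u → ∀ i : Fin (n - 1),
        v (hi i) < v (lo i) → ∀ f : MvPolynomial (Fin n) R,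
          divDiffPerm v f = divDiffPerm (v * simple i) (divDiff i f) :=
      fun v hv i h f => ih _ hv v h f rfl
    -- The definition removes its own descent j; the two preceding lemmas join the route through j
    -- with the route through i.
    obtain ⟨j, hj, hstep⟩ := exists_divDiffPerm_step ⟨i, h⟩
    rw [hstep]
    rcases lt_trichotomy i.1 j.1 with hlt | heq | hgt
    · rcases (Nat.succ_le_of_lt hlt).eq_or_lt with h1 | h1
      · exact (divDiffPerm_step_adjacent ih' h1 h hj f).symm
      · exact (divDiffPerm_step_far ih' h1 h hj f).symm
    · rw [Fin.ext heq]
    · rcases (Nat.succ_le_of_lt hgt).eq_or_lt with h1 | h1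
      · exact divDiffPerm_step_adjacent ih' h1 hj h f
      · exact divDiffPerm_step_far ih' h1 hj h f

theorem exists_divDiffPerm_eq_lin (u : Equiv.Perm (Fin n)) :
    ∃ L : MvPolynomial (Fin n) R →ₗ[R] MvPolynomial (Fin n) R, ∀ f, divDiffPerm u f = L f := by
  induction hw : weight u using Nat.strong_induction_on generalizing u with
  | _ N ih =>
    subst hw
    by_cases h : ∃ i : Fin (n - 1), u (hi i) < u (lo i)
    · obtain ⟨i, hi'⟩ := h
      obtain ⟨L, hL⟩ := ih _ (weight_lt u i hi') _ rfl
      exact ⟨L ∘ₗ divDiffLin R i, fun f => by rw [divDiffPerm_of_descent u hi', hL]; rfl⟩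
    · exact ⟨LinearMap.id, fun f => divDiffPerm_of_no_descent h f⟩

/-- The operator `∂_u` as a linear map. -/
noncomputable def divDiffPermLin (R : Type*) [CommRing R] [IsDomain R] (u : Equiv.Perm (Fin n)) :
    MvPolynomial (Fin n) R →ₗ[R] MvPolynomial (Fin n) R where
  toFun := divDiffPerm u
  map_add' f g := by
    obtain ⟨L, hL⟩ := exists_divDiffPerm_eq_lin (R := R) u
    rw [hL, hL, hL, map_add]
  map_smul' c f := by
    obtain ⟨L, hL⟩ := exists_divDiffPerm_eq_lin (R := R) u
    rw [hL, hL, map_smul, RingHom.id_apply]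

theorem divDiffPermLin_apply (u : Equiv.Perm (Fin n)) (f : MvPolynomial (Fin n) R) :
    divDiffPermLin R u f = divDiffPerm u f := rfl

theorem divDiffPerm_symm_mul (u : Equiv.Perm (Fin n)) {f : MvPolynomial (Fin n) R}
    (hf : f.IsSymmetric) (g : MvPolynomial (Fin n) R) :
    divDiffPerm u (f * g) = f * divDiffPerm u g := by
  induction hw : weight u using Nat.strong_induction_on generalizing u g with
  | _ N ih =>
    subst hw
    by_cases h : ∃ i : Fin (n - 1), u (hi i) < u (lo i)
    · obtain ⟨i, hi'⟩ := h
      rw [divDiffPerm_of_descent u hi', divDiffPerm_of_descent u hi', divDiff_symm_mul (hf _),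
        ih _ (weight_lt u i hi') _ _ rfl]
    · rw [divDiffPerm_of_no_descent h, divDiffPerm_of_no_descent h]

theorem divDiffPerm_map {S : Type*} [CommRing S] [IsDomain S] (φ : R →+* S)
    (u : Equiv.Perm (Fin n)) (f : MvPolynomial (Fin n) R) :
    divDiffPerm u (map φ f) = map φ (divDiffPerm u f) := by
  induction hw : weight u using Nat.strong_induction_on generalizing u f with
  | _ N ih =>
    subst hw
    by_cases h : ∃ i : Fin (n - 1), u (hi i) < u (lo i)
    · obtain ⟨i, hi'⟩ := h
      rw [divDiffPerm_of_descent u hi', divDiffPerm_of_descent u hi', divDiff_map,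
        ih _ (weight_lt u i hi') _ _ rfl]
    · rw [divDiffPerm_of_no_descent h, divDiffPerm_of_no_descent h]

/-- If i is a descent of u, then ∂_u ends in ∂_i and ∂_i² = 0 kills the product; otherwise the
product is ∂_{u s_i}. -/
theorem divDiffPerm_divDiff_mem (u : Equiv.Perm (Fin n)) (i : Fin (n - 1)) :
    divDiffPermLin R u * divDiffLin R i ∈
      Submodule.span ℤ (Set.range (divDiffPermLin (n := n) R)) := by
  by_cases h : u (hi i) < u (lo i)
  · have : divDiffPermLin R u * divDiffLin R i = 0 := by
      refine LinearMap.ext fun f => ?_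
      change divDiffPerm u (divDiff i f) = 0
      rw [divDiffPerm_of_descent u h, divDiff_divDiff, ← divDiffPermLin_apply, map_zero]
    rw [this]
    exact zero_mem _
  · have h' : (u * simple i) (hi i) < (u * simple i) (lo i) := by
      rw [Equiv.Perm.mul_apply, Equiv.Perm.mul_apply, simple_hi, simple_lo]
      exact lt_of_le_of_ne (not_lt.1 h) fun e => lo_ne_hi i (u.injective e)
    have : divDiffPermLin R u * divDiffLin R i = divDiffPermLin R (u * simple i) := by
      refine LinearMap.ext fun f => ?_
      change divDiffPerm u (divDiff i f) = divDiffPerm (u * simple i) f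
      rw [divDiffPerm_of_descent _ h', mul_assoc]
      congr 1
      rw [simple, Equiv.swap_mul_self, mul_one]
    rw [this]
    exact Submodule.subset_span ⟨_, rfl⟩

/-- The algebra generated by the divided differences of index at least `k`. -/
noncomputable def nilCoxeter (n : ℕ) (R : Type*) [CommRing R] [IsDomain R] (k : ℕ) :
    Subalgebra ℤ (Module.End R (MvPolynomial (Fin n) R)) :=
  Algebra.adjoin ℤ {D | ∃ i : Fin (n - 1), k ≤ i.1 ∧ D = divDiffLin R i}

/-- The span of the ∂_u contains 1 = ∂_1 and is stable under right multiplication by the generators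
∂_i. -/
theorem mem_span_divDiffPerm_of_mem_nilCoxeter {k : ℕ}
    {D : Module.End R (MvPolynomial (Fin n) R)} (hD : D ∈ nilCoxeter n R k) :
    D ∈ Submodule.span ℤ (Set.range (divDiffPermLin (n := n) R)) := by
  set V := Submodule.span ℤ (Set.range (divDiffPermLin (n := n) R)) with hV
  have key : ∀ E ∈ V, E * D ∈ V := by
    induction hD using Algebra.adjoin_induction with
    | mem D hD =>
      obtain ⟨i, -, rfl⟩ := hD
      intro E hE
      induction hE using Submodule.span_induction with
      | mem E hE =>
        obtain ⟨u, rfl⟩ := hE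
        exact divDiffPerm_divDiff_mem u i
      | zero => rw [zero_mul]; exact zero_mem _
      | add E F _ _ hE hF => rw [add_mul]; exact add_mem hE hF
      | smul c E _ hE => rw [smul_mul_assoc]; exact V.smul_mem _ hE
    | algebraMap r =>
      intro E hE
      rw [← Algebra.commutes, ← Algebra.smul_def]
      exact V.smul_mem _ hE
    | add D D' _ _ h h' =>
      intro E hE
      rw [mul_add]
      exact add_mem (h E hE) (h' E hE)
    | mul D D' _ _ h h' =>
      intro E hE
      rw [← mul_assoc]
      exact h' _ (h E hE)
  have h1 : divDiffPermLin R (1 : Equiv.Perm (Fin n)) = 1 :=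
    LinearMap.ext fun f => divDiffPerm_one f
  have := key _ (Submodule.subset_span ⟨1, rfl⟩)
  rwa [h1, one_mul] at this

theorem nilCoxeter_mono {k l : ℕ} (h : k ≤ l) : nilCoxeter n R l ≤ nilCoxeter n R k :=
  Algebra.adjoin_mono fun _ ⟨i, hi', e⟩ => ⟨i, h.trans hi', e⟩

/-- For i ≥ k > j the transposition s_i fixes the variable X_j, which therefore behaves as a scalar.
-/
theorem nilCoxeter_X_pow_mul {k : ℕ} {D : Module.End R (MvPolynomial (Fin n) R)}
    (hD : D ∈ nilCoxeter n R k) {j : Fin n} (hj : j.1 < k) (m : ℕ) (f : MvPolynomial (Fin n) R) :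
    D (X j ^ m * f) = X j ^ m * D f := by
  induction hD using Algebra.adjoin_induction generalizing f with
  | mem D hD =>
    obtain ⟨i, hik, rfl⟩ := hD
    refine divDiff_symm_mul ?_ f
    rw [map_pow, rename_X, simple_of_ne]
    · rintro rfl; simp only [lo] at hj; omega
    · rintro rfl; simp only [hi] at hj; omega
  | algebraMap r =>
    rw [Algebra.algebraMap_eq_smul_one, LinearMap.smul_apply, LinearMap.smul_apply,
      Module.End.one_apply, Module.End.one_apply, mul_smul_comm]
  | add D D' _ _ h h' => rw [LinearMap.add_apply, LinearMap.add_apply, h, h', mul_add]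
  | mul D D' _ _ h h' => rw [Module.End.mul_apply, Module.End.mul_apply, h', h]

end PermutationOperators

/-! ### Extracting staircase coefficients by divided differences -/

section Extraction

variable {n : ℕ} {R : Type*} [CommRing R] [IsDomain R]

theorem divDiff_X_lo (i : Fin (n - 1)) : divDiff i (X (lo i) : MvPolynomial (Fin n) R) = 1 := by
  apply divDiff_eq
  rw [rename_X, simple_lo, mul_one]

theorem divDiff_X_hi_mul (i : Fin (n - 1)) (f : MvPolynomial (Fin n) R)
    (hf : divDiff i f = 0) (g : MvPolynomial (Fin n) R) :
    divDiff i (f + X (lo i) * g) = g + X (hi i) * divDiff i g := by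
  rw [divDiff_add, hf, divDiff_mul, divDiff_X_lo, rename_X, simple_lo, zero_add, one_mul]

/-- Divided differences lower the order of vanishing at the origin by at most one. -/
theorem divDiff_mem_ker_pow (i : Fin (n - 1)) (r : ℕ) {f : MvPolynomial (Fin n) R}
    (hf : f ∈ RingHom.ker (constantCoeff (σ := Fin n) (R := R)) ^ (r + 1)) :
    divDiff i f ∈ RingHom.ker (constantCoeff (σ := Fin n) (R := R)) ^ r := by
  induction r generalizing f with
  | zero => simp
  | succ r ih =>
    rw [pow_succ'] at hf
    refine Submodule.mul_induction_on hf (fun x hx g hg => ?_) fun a b ha hb => ?_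
    · rw [divDiff_mul]
      refine add_mem (Ideal.mul_mem_left _ _ hg) ?_
      rw [pow_succ']
      refine Ideal.mul_mem_mul ?_ (ih hg)
      rw [RingHom.mem_ker] at hx ⊢
      rw [constantCoeff_rename, hx]
    · rw [divDiff_add]
      exact add_mem ha hb

/-- The composite `∂_{k+b-1} ⋯ ∂_{k+1} ∂_k`. -/
noncomputable def divDiffChain (n : ℕ) (R : Type*) [CommRing R] [IsDomain R] (k : ℕ) :
    ℕ → Module.End R (MvPolynomial (Fin n) R)
  | 0 => 1
  | b + 1 => if h : k + b < n - 1 then divDiffLin R ⟨k + b, h⟩ * divDiffChain n R k b else 0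

theorem divDiffChain_succ {k b : ℕ} (h : k + b < n - 1) (f : MvPolynomial (Fin n) R) :
    divDiffChain n R k (b + 1) f = divDiff ⟨k + b, h⟩ (divDiffChain n R k b f) := by
  rw [divDiffChain, dif_pos h]; rfl

theorem divDiffChain_mem (k b : ℕ) : divDiffChain n R k b ∈ nilCoxeter n R k := by
  induction b with
  | zero => exact one_mem _
  | succ b ih =>
    rw [divDiffChain]
    split_ifs with h
    · exact mul_mem (Algebra.subset_adjoin ⟨_, Nat.le_add_right _ _, rfl⟩) ih
    · exact zero_mem _

theorem divDiffChain_comm {k b : ℕ} {j : Fin (n - 1)} (hj : k + b < j.1)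
    (f : MvPolynomial (Fin n) R) :
    divDiff j (divDiffChain n R k b f) = divDiffChain n R k b (divDiff j f) := by
  induction b with
  | zero => rfl
  | succ b ih =>
    have h : k + b < n - 1 := by omega
    rw [divDiffChain_succ h, divDiffChain_succ h, ← ih (by omega)]
    exact (divDiff_comm (by simp only; omega) _).symm

theorem divDiffChain_mem_ker_pow {k b : ℕ} (r : ℕ) {f : MvPolynomial (Fin n) R}
    (hf : f ∈ RingHom.ker (constantCoeff (σ := Fin n) (R := R)) ^ (r + b)) :
    divDiffChain n R k b f ∈ RingHom.ker (constantCoeff (σ := Fin n) (R := R)) ^ r := by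
  induction b generalizing r with
  | zero => exact hf
  | succ b ih =>
    rw [divDiffChain]
    split_ifs with h
    · refine divDiff_mem_ker_pow _ r (ih (r + 1) ?_)
      rwa [add_assoc, add_comm 1 b]
    · exact zero_mem _

/-- A chain of b divided differences turns X_k^m into the complete homogeneous polynomial of degree
m - b in X_k, …, X_{k+b}. This is the recursion of these polynomials on the last variable. -/
theorem divDiffChain_X_pow_succ {k b : ℕ} (h : k + b < n - 1) (m : ℕ) :
    divDiffChain n R k (b + 1) (X ⟨k, by omega⟩ ^ (m + 1)) =
      divDiffChain n R k b (X ⟨k, by omega⟩ ^ m) +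
        X ⟨k + b + 1, by omega⟩ * divDiffChain n R k (b + 1) (X ⟨k, by omega⟩ ^ m) := by
  induction b with
  | zero =>
    rw [divDiffChain_succ h, divDiffChain_succ h, pow_succ']
    have := divDiff_X_hi_mul (R := R) ⟨k + 0, h⟩ 0 (map_zero (divDiffLin R _)) (X ⟨k, by omega⟩ ^ m)
    rw [zero_add] at this
    exact this
  | succ b ih =>
    have h' : k + b < n - 1 := by omega
    rw [divDiffChain_succ h, ih h', divDiffChain_succ h]
    refine divDiff_X_hi_mul ⟨k + (b + 1), h⟩ _ ?_ _
    -- The new divided difference kills the shorter chain: it commutes past it and meets a power of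
    -- X_k, which its transposition fixes.
    rw [divDiffChain_comm (by simp only; omega), divDiff_of_symm, map_zero]
    rw [map_pow, rename_X, simple_of_ne] <;> simp only [lo, hi, ne_eq, Fin.mk.injEq] <;> omega

theorem divDiffChain_X_pow {k b : ℕ} (h : k + b < n) :
    divDiffChain n R k b (X ⟨k, by omega⟩ ^ b) = 1 := by
  induction b with
  | zero => rw [pow_zero]; rfl
  | succ b ih =>
    have h' : k + b < n - 1 := by omega
    rw [divDiffChain_X_pow_succ h', ih (by omega), divDiffChain_succ h', ih (by omega),
      divDiff_of_symm (map_one _), mul_zero, add_zero]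

/-- The exponent `(n-1, n-2, …, 0)`. -/
noncomputable def stair (n : ℕ) : Fin n →₀ ℕ := Finsupp.equivFunOnFinite.symm fun j => n - 1 - j.1

theorem stair_apply (j : Fin n) : stair n j = n - 1 - j.1 := rfl

/-- A chain of length b lowers the order of vanishing at 0 by at most b. So any term of order above
b contributes nothing, and for m = b only f(0) X_k^b remains, which the chain sends to f(0). -/
theorem constantCoeff_divDiffChain_X_pow_mul {k b m : ℕ} (h : k + b < n) (hbm : b ≤ m)
    (f : MvPolynomial (Fin n) R) :
    constantCoeff (divDiffChain n R k b (X ⟨k, by omega⟩ ^ m * f)) =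
      if m = b then constantCoeff f else 0 := by
  set J := RingHom.ker (constantCoeff (σ := Fin n) (R := R)) with hJ
  have hX : ∀ m, (X ⟨k, by omega⟩ : MvPolynomial (Fin n) R) ^ m ∈ J ^ m := fun m =>
    Ideal.pow_mem_pow (by rw [RingHom.mem_ker, constantCoeff_X]) m
  have hz : ∀ g ∈ J ^ (b + 1), constantCoeff (divDiffChain n R k b g) = 0 := by
    intro g hg
    have := divDiffChain_mem_ker_pow (k := k) (b := b) 1 (by rwa [add_comm 1 b])
    rwa [pow_one, RingHom.mem_ker] at this
  split_ifs with hm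
  · subst hm
    have e : (X ⟨k, by omega⟩ : MvPolynomial (Fin n) R) ^ m * f =
        X ⟨k, by omega⟩ ^ m * (f - C (constantCoeff f)) +
          constantCoeff f • X ⟨k, by omega⟩ ^ m := by
      rw [smul_eq_C_mul]; ring
    rw [e, map_add, map_add, hz, map_smul, divDiffChain_X_pow h, zero_add, smul_eq_C_mul, mul_one,
      constantCoeff_C]
    rw [pow_succ]
    refine Ideal.mul_mem_mul (hX m) ?_
    rw [RingHom.mem_ker, map_sub, constantCoeff_C, sub_self]
  · refine hz _ (Ideal.mul_mem_right _ _ (Ideal.pow_le_pow_right ?_ (hX m)))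
    omega

/-- Induction downwards on the first variable that may occur, and then upwards on its exponent in a.
The operator for the remaining variables does not see X_k, and a chain of length b reads off the
exponent b of X_k. -/
theorem exists_nilCoxeter_extract (k : ℕ) (hk : k ≤ n) (a : Fin n →₀ ℕ) (ha : a ≤ stair n)
    (hak : ∀ j : Fin n, j.1 < k → a j = 0) :
    ∃ D ∈ nilCoxeter n ℤ k, ∀ c : Fin n →₀ ℕ, c ≤ stair n → (∀ j : Fin n, j.1 < k → c j = 0) →
      constantCoeff (D (monomial c 1)) = if c = a then 1 else 0 := by
  classical
  induction hk using Nat.decreasingInduction generalizing a with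
  | self =>
    refine ⟨1, one_mem _, fun c _ hc => ?_⟩
    have h1 : c = 0 := Finsupp.ext fun j => hc j j.2
    have h2 : a = 0 := Finsupp.ext fun j => hak j j.2
    rw [h1, h2, if_pos rfl, Module.End.one_apply, constantCoeff_monomial, if_pos rfl]
  | of_succ k hk ih =>
    have hkn : k < n := hk
    set κ : Fin n := ⟨k, hkn⟩ with hκ
    have herase : ∀ c : Fin n →₀ ℕ, c ≤ stair n → (∀ j : Fin n, j.1 < k → c j = 0) →
        c.erase κ ≤ stair n ∧ ∀ j : Fin n, j.1 < k + 1 → c.erase κ j = 0 := by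
      intro c hc hck
      refine ⟨fun j => ?_, fun j hj => ?_⟩
      · rw [Finsupp.erase_apply]
        split_ifs
        · exact Nat.zero_le _
        · exact hc j
      · rw [Finsupp.erase_apply]
        split_ifs with h
        · rfl
        · exact hck j (lt_of_le_of_ne (Nat.lt_succ_iff.1 hj) fun e => h (Fin.ext e))
    induction hb : a κ using Nat.strong_induction_on generalizing a with
    | _ b ihb =>
      obtain ⟨D', hD', hval⟩ := ih (a.erase κ) (herase a ha hak).1 (herase a ha hak).2
      have hbn : k + b < n := by
        have := ha κ
        rw [hb, stair_apply] at this
        simp only [hκ] at this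
        omega
      -- `D₀` has the right values on all monomials whose exponent at κ is at least b. Its values on
      -- the finitely many others, collected in `T`, are cancelled below by the operators already
      -- found for smaller exponents.
      set D₀ := divDiffChain n ℤ k b * D' with hD₀
      have hD₀mem : D₀ ∈ nilCoxeter n ℤ k :=
        mul_mem (divDiffChain_mem k b) (nilCoxeter_mono (Nat.le_succ k) hD')
      have hD₀val : ∀ c : Fin n →₀ ℕ, c ≤ stair n → (∀ j : Fin n, j.1 < k → c j = 0) → b ≤ c κ →
          constantCoeff (D₀ (monomial c 1)) = if c = a then 1 else 0 := by
        intro c hc hck hbc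
        have e : (monomial c 1 : MvPolynomial (Fin n) ℤ) =
            X κ ^ c κ * monomial (c.erase κ) 1 := by
          rw [X_pow_eq_monomial, monomial_mul, one_mul, Finsupp.single_add_erase]
        rw [e, hD₀, Module.End.mul_apply, nilCoxeter_X_pow_mul hD' (Nat.lt_succ_self k),
          constantCoeff_divDiffChain_X_pow_mul hbn hbc,
          hval _ (herase c hc hck).1 (herase c hc hck).2, ← ite_and]
        congr 1
        refine propext ⟨fun ⟨h1, h2⟩ => ?_, ?_⟩
        · rw [← Finsupp.single_add_erase κ c, ← Finsupp.single_add_erase κ a, h1, h2, hb]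
        · rintro rfl
          exact ⟨hb, rfl⟩
      set T := (Finset.Iic (stair n)).filter
        fun c => (∀ j : Fin n, j.1 < k → c j = 0) ∧ c κ < b with hT
      have hDc : ∀ c ∈ T, ∃ D ∈ nilCoxeter n ℤ k, ∀ c' : Fin n →₀ ℕ, c' ≤ stair n →
          (∀ j : Fin n, j.1 < k → c' j = 0) →
          constantCoeff (D (monomial c' 1)) = if c' = c then 1 else 0 := by
        intro c hc
        rw [hT, Finset.mem_filter, Finset.mem_Iic] at hc
        exact ihb (c κ) hc.2.2 c hc.1 hc.2.1 rfl
      choose! Dc hDcmem hDcval using hDc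
      refine ⟨D₀ - ∑ c ∈ T, constantCoeff (D₀ (monomial c 1)) • Dc c,
        sub_mem hD₀mem (sum_mem fun c hc => Subalgebra.smul_mem _ (hDcmem c hc) _), ?_⟩
      intro c hc hck
      have hsum : constantCoeff ((∑ c' ∈ T, constantCoeff (D₀ (monomial c' 1)) • Dc c')
          (monomial c 1)) = if c ∈ T then constantCoeff (D₀ (monomial c 1)) else 0 := by
        rw [LinearMap.sum_apply, map_sum, 
          ← Finset.sum_ite_eq T c fun c' => constantCoeff (D₀ (monomial c' 1))]
        refine Finset.sum_congr rfl fun c' hc' => ?_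
        rw [LinearMap.smul_apply, constantCoeff_smul, hDcval c' hc' c hc hck, smul_eq_mul,
          mul_ite, mul_one, mul_zero]
      rw [LinearMap.sub_apply, map_sub, hsum]
      split_ifs with h1 h2 h2
      · rw [hT, Finset.mem_filter] at h1
        rw [h2, hb] at h1
        exact absurd h1.2.2 (lt_irrefl _)
      · exact sub_self _
      · rw [sub_zero, hD₀val c hc hck (by rw [h2, hb]), if_pos h2]
      · rw [sub_zero, hD₀val c hc hck, if_neg h2]
        by_contra hlt
        exact h1 (by
          rw [hT, Finset.mem_filter, Finset.mem_Iic]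
          exact ⟨hc, hck, not_le.1 hlt⟩)

/-- The coefficient of a staircase monomial is an integral combination of the functionals
`f ↦ (∂_v f)(0)` on polynomials supported on the staircase. -/
theorem exists_coeff_eq_sum_divDiffPerm {a : Fin n →₀ ℕ} (ha : a ≤ stair n) :
    ∃ N : Equiv.Perm (Fin n) → ℤ, ∀ (S : Type*) [CommRing S] [IsDomain S] (c : Fin n →₀ ℕ),
      c ≤ stair n → ∑ v, (N v : S) * constantCoeff (divDiffPerm v (monomial c (1 : S))) =
        if c = a then 1 else 0 := by
  classical
  obtain ⟨D, hD, hval⟩ := exists_nilCoxeter_extract (n := n) 0 (Nat.zero_le n) a ha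
    fun j hj => absurd hj (Nat.not_lt_zero _)
  obtain ⟨N, hN⟩ := (Submodule.mem_span_range_iff_exists_fun ℤ).1
    (mem_span_divDiffPerm_of_mem_nilCoxeter hD)
  refine ⟨N, fun S _ _ c hc => ?_⟩
  -- The integers N come from the identity over ℤ, which is transported along ℤ → S; divided
  -- differences commute with this base change.
  have h := congrArg (Int.castRingHom S)
    (hval c hc fun j hj => absurd hj (Nat.not_lt_zero _))
  rw [← hN, LinearMap.sum_apply, map_sum, map_sum] at h
  have e : (monomial c (1 : S)) = map (Int.castRingHom S) (monomial c 1) := by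
    rw [map_monomial, (Int.castRingHom S).map_one]
  rw [apply_ite (Int.castRingHom S), (Int.castRingHom S).map_one, (Int.castRingHom S).map_zero] at h
  rw [← h]
  refine Finset.sum_congr rfl fun v _ => ?_
  rw [e, divDiffPerm_map, LinearMap.smul_apply, constantCoeff_smul, smul_eq_mul, map_mul,
    divDiffPermLin_apply, constantCoeff_map]
  rfl

end Extraction

/-! ### Recursion for quantum elementary polynomials and the case q = 0 -/

section ElementaryRecursion

variable {A : Type*} [CommRing A]

/-- The quantum elementary polynomials `e_i(v_0, …, v_{k-1} | q_0, …, q_{k-2})`, by recursion. -/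
def qe (v q : ℕ → A) : ℕ → ℕ → A
  | _, 0 => 1
  | 0, _ + 1 => 0
  | 1, 1 => v 0
  | 1, _ + 2 => 0
  | k + 2, 1 => qe v q (k + 1) 1 + v (k + 1)
  | k + 2, i + 2 => qe v q (k + 1) (i + 2) + v (k + 1) * qe v q (k + 1) (i + 1) + q k * qe v q k i

theorem qe_zero_right (v q : ℕ → A) (k : ℕ) : qe v q k 0 = 1 := by
  rcases k with _ | _ | k <;> simp [qe]

theorem qe_of_lt (v q : ℕ → A) {k i : ℕ} (h : k < i) : qe v q k i = 0 := by
  induction k using Nat.strong_induction_on generalizing i with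
  | _ k ih =>
    match k, i, h with
    | 0, i + 1, _ => simp [qe]
    | 1, i + 2, _ => simp [qe]
    | k + 2, i + 2, h =>
      rw [qe, ih (k + 1) (by omega) (by omega), ih (k + 1) (by omega) (by omega),
        ih k (by omega) (by omega)]
      ring

theorem qe_succ_one (v q : ℕ → A) (k : ℕ) : qe v q (k + 1) 1 = qe v q k 1 + v k := by
  rcases k with _ | k <;> simp [qe]

theorem qe_succ_succ_zero (v : ℕ → A) (k i : ℕ) :
    qe v 0 (k + 1) (i + 1) = qe v 0 k (i + 1) + v k * qe v 0 k i := by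
  rcases i with _ | i
  · rw [zero_add, qe_succ_one, qe_zero_right, mul_one]
  · rcases k with _ | k
    · simp [qe]
    · rw [qe, Pi.zero_apply, zero_mul, add_zero]

theorem map_qe {B : Type*} [CommRing B] (φ : A →+* B) (v q : ℕ → A) (k i : ℕ) :
    φ (qe v q k i) = qe (φ ∘ v) (φ ∘ q) k i := by
  induction k using Nat.strong_induction_on generalizing i with
  | _ k ih =>
    match k, i with
    | k, 0 => rw [qe_zero_right, qe_zero_right, map_one]
    | 0, i + 1 => simp [qe]
    | 1, 1 => simp [qe]
    | 1, i + 2 => simp [qe]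
    | k + 2, 1 => rw [qe, qe, map_add, ih (k + 1) (by omega)]; rfl
    | k + 2, i + 2 =>
      rw [qe, qe, map_add, map_add, map_mul, map_mul, ih (k + 1) (by omega),
        ih (k + 1) (by omega), ih k (by omega)]
      rfl

theorem qe_zero_eq_esymm (v : ℕ → A) (k i : ℕ) :
    qe v 0 k i = ((Multiset.range k).map v).esymm i := by
  induction k generalizing i with
  | zero =>
    rcases i with _ | i
    · simp [qe, Multiset.esymm]
    · rw [qe_of_lt _ _ (Nat.succ_pos i), Multiset.esymm, Multiset.powersetCard_eq_empty] <;> simp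
  | succ k ih =>
    rcases i with _ | i
    · rw [qe_zero_right]; simp [Multiset.esymm]
    · rw [qe_succ_succ_zero, ih, ih, Multiset.range_succ, Multiset.map_cons, Multiset.esymm,
        Multiset.esymm, Multiset.esymm, Multiset.powersetCard_cons, Multiset.map_add,
        Multiset.sum_add, Multiset.map_map]
      simp only [Function.comp_def, Multiset.prod_cons, Multiset.sum_map_mul_left]

theorem qe_zero_eq_esymm_fin (v : ℕ → A) (n i : ℕ) :
    qe v 0 n i = ((Finset.univ : Finset (Fin n)).val.map fun j => v j.1).esymm i := by
  rw [qe_zero_eq_esymm]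
  congr 1
  rw [Fin.univ_val_map, ← Multiset.coe_range, Multiset.map_coe, List.ofFn_eq_map,
    ← List.map_coe_finRange_eq_range, List.map_map]
  rfl

/-- Classical elementary polynomials are symmetric. The reversal is needed later to turn a bound j
on the exponent of the j-th adjoined variable into the staircase bound. -/
theorem qe_zero_rev (v : ℕ → A) (n i : ℕ) :
    qe (fun j => v (n - 1 - j)) 0 n i = qe v 0 n i := by
  rw [qe_zero_eq_esymm_fin, qe_zero_eq_esymm_fin]
  congr 1
  conv_rhs => rw [← Finset.map_univ_equiv (Fin.revPerm (n := n)), Finset.map_val, Multiset.map_map]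
  refine Multiset.map_congr rfl fun j _ => ?_
  simp only [Function.comp_apply, Equiv.coe_toEmbedding, Fin.revPerm_apply, Fin.val_rev]
  congr 1
  omega

end ElementaryRecursion

/-! ### Spanning over symmetric polynomials, one variable at a time -/

section ClassicalSpanning

variable (R : Type*) [CommRing R] {A : Type*} [CommRing A] [Algebra R A] (v : ℕ → A)

/-- The algebra generated by the elementary symmetric polynomials in `v_0, …, v_{k-1}`. -/
def esymmAdjoin (k : ℕ) : Subalgebra R A :=
  Algebra.adjoin R (Set.range fun i : Fin k => qe v 0 k (i.1 + 1))

theorem qe_mem_esymmAdjoin (k i : ℕ) : qe v 0 k i ∈ esymmAdjoin R v k := by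
  rcases i with _ | i
  · rw [qe_zero_right]; exact one_mem _
  · by_cases h : i < k
    · exact Algebra.subset_adjoin ⟨⟨i, h⟩, rfl⟩
    · rw [qe_of_lt _ _ (by omega)]; exact zero_mem _

/-- The span of `e_0, …, e_k` in the variables `v_0, …, v_{k-1}`. -/
def esymmSpan (k : ℕ) : Submodule R A := Submodule.span R {z | ∃ i ≤ k, z = qe v 0 k i}

/-- The span of `1, v_k, …, v_k^m`. -/
def powSpan (k m : ℕ) : Submodule R A := Submodule.span R {z | ∃ i ≤ m, z = v k ^ i}

/-- Let T be the algebra of multipliers of the right side N. It contains the e_i in k + 1 variables.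
It contains v_k, because v_k e_i = e_{i+1}(v_0, …, v_k) - e_{i+1}(v_0, …, v_{k-1}), the last term
being 0 for i = k. Hence it also contains the e_i in k variables, and since 1 lies in N, T is
contained in N. -/
theorem esymmAdjoin_mul_adjoin_le (k : ℕ) :
    Subalgebra.toSubmodule (esymmAdjoin R v k) *
        Subalgebra.toSubmodule (Algebra.adjoin R {v k}) ≤
      esymmSpan R v k * Subalgebra.toSubmodule (esymmAdjoin R v (k + 1)) := by
  set N := esymmSpan R v k * Subalgebra.toSubmodule (esymmAdjoin R v (k + 1)) with hN
  have hgen : ∀ i ≤ k, ∀ b ∈ esymmAdjoin R v (k + 1), qe v 0 k i * b ∈ N := fun i hi b hb =>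
    Submodule.mul_mem_mul (Submodule.subset_span ⟨i, hi, rfl⟩) hb
  let T : Subalgebra R A :=
    { carrier := {z | ∀ m ∈ N, z * m ∈ N}
      mul_mem' := fun {a b} ha hb m hm => by rw [mul_assoc]; exact ha _ (hb _ hm)
      add_mem' := fun {a b} ha hb m hm => by rw [add_mul]; exact add_mem (ha _ hm) (hb _ hm)
      algebraMap_mem' := fun r m hm => by rw [← Algebra.smul_def]; exact N.smul_mem _ hm }
  have hT : ∀ z : A, (∀ i ≤ k, ∀ b ∈ esymmAdjoin R v (k + 1), z * (qe v 0 k i * b) ∈ N) →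
      z ∈ T := by
    intro z hz m hm
    induction hm using Submodule.mul_induction_on' with
    | mem_mul_mem x hx b hb =>
      induction hx using Submodule.span_induction with
      | mem x hx =>
        obtain ⟨i, hi, rfl⟩ := hx
        exact hz i hi b hb
      | zero => rw [zero_mul, mul_zero]; exact zero_mem _
      | add x y _ _ hx hy => rw [add_mul, mul_add]; exact add_mem hx hy
      | smul c x _ hx => rw [smul_mul_assoc, mul_smul_comm]; exact N.smul_mem _ hx
    | add x _ y _ hx hy => rw [mul_add]; exact add_mem hx hy
  have hB : ∀ b ∈ esymmAdjoin R v (k + 1), b ∈ T := fun b hb => hT b fun i hi b' hb' => by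
    rw [mul_left_comm]
    exact hgen i hi _ (mul_mem hb hb')
  have hv : v k ∈ T := hT _ fun i hi b hb => by
    have e : v k * (qe v 0 k i * b) =
        qe v 0 k 0 * (qe v 0 (k + 1) (i + 1) * b) - qe v 0 k (i + 1) * b := by
      rw [qe_succ_succ_zero, qe_zero_right]; ring
    rw [e]
    refine sub_mem (hgen 0 (Nat.zero_le _) _ (mul_mem (qe_mem_esymmAdjoin R v _ _) hb)) ?_
    rcases hi.eq_or_lt with rfl | hlt
    · rw [qe_of_lt v 0 (Nat.lt_succ_self i), zero_mul]; exact zero_mem _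
    · exact hgen _ hlt b hb
  have he : ∀ i, qe v 0 k i ∈ T := by
    intro i
    induction i with
    | zero => rw [qe_zero_right]; exact one_mem _
    | succ i ih =>
      have e : qe v 0 k (i + 1) = qe v 0 (k + 1) (i + 1) - v k * qe v 0 k i := by
        rw [qe_succ_succ_zero]; ring
      rw [e]
      exact sub_mem (hB _ (qe_mem_esymmAdjoin R v _ _)) (mul_mem hv ih)
  have h1 : esymmAdjoin R v k ≤ T := Algebra.adjoin_le (by rintro _ ⟨i, rfl⟩; exact he _)
  have h2 : Algebra.adjoin R {v k} ≤ T := Algebra.adjoin_le (by rintro _ rfl; exact hv)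
  rw [Submodule.mul_le]
  intro a ha b hb
  have h3 := mul_mem (h1 ha) (h2 hb) 1 (by
    have := hgen 0 (Nat.zero_le _) 1 (one_mem _)
    rwa [qe_zero_right, one_mul] at this)
  rwa [mul_one] at h3

/-- Iteration of e_{i+1}(v_0, …, v_{k-1}) = e_{i+1}(v_0, …, v_k) - v_k e_i(v_0, …, v_{k-1}) raises
the power of v_k by one at each step. -/
theorem qe_mem_powSpan_mul (k i : ℕ) :
    qe v 0 k i ∈ powSpan R v k i * Subalgebra.toSubmodule (esymmAdjoin R v (k + 1)) := by
  induction i with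
  | zero =>
    rw [qe_zero_right, ← mul_one (1 : A)]
    exact Submodule.mul_mem_mul (Submodule.subset_span ⟨0, le_rfl, (pow_zero _).symm⟩)
      (one_mem (esymmAdjoin R v (k + 1)))
  | succ i ih =>
    have e : qe v 0 k (i + 1) = 1 * qe v 0 (k + 1) (i + 1) - v k * qe v 0 k i := by
      rw [qe_succ_succ_zero]; ring
    rw [e]
    refine sub_mem (Submodule.mul_mem_mul
      (Submodule.subset_span ⟨0, Nat.zero_le _, (pow_zero _).symm⟩)
      (qe_mem_esymmAdjoin R v _ _)) ?_
    have h1 : Submodule.span R {v k} * powSpan R v k i ≤ powSpan R v k (i + 1) := by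
      rw [powSpan, Submodule.span_mul_span, Submodule.span_le]
      rintro _ ⟨_, rfl, _, ⟨j, hj, rfl⟩, rfl⟩
      exact Submodule.subset_span ⟨j + 1, by omega, (pow_succ' _ _).symm⟩
    have h2 := Submodule.mul_mem_mul (Submodule.mem_span_singleton_self (R := R) (v k)) ih
    rw [← mul_assoc] at h2
    exact mul_le_mul' h1 le_rfl h2

theorem esymmSpan_le (k : ℕ) : esymmSpan R v k ≤
    powSpan R v k k * Subalgebra.toSubmodule (esymmAdjoin R v (k + 1)) := by
  rw [esymmSpan, Submodule.span_le]
  rintro _ ⟨i, hi, rfl⟩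
  refine mul_le_mul' (Submodule.span_mono ?_) le_rfl (qe_mem_powSpan_mul R v k i)
  rintro _ ⟨j, hj, rfl⟩
  exact ⟨j, hj.trans hi, rfl⟩

theorem esymmAdjoin_mul_adjoin_le_powSpan (k : ℕ) :
    Subalgebra.toSubmodule (esymmAdjoin R v k) *
        Subalgebra.toSubmodule (Algebra.adjoin R {v k}) ≤
      powSpan R v k k * Subalgebra.toSubmodule (esymmAdjoin R v (k + 1)) := by
  refine (esymmAdjoin_mul_adjoin_le R v k).trans
    ((mul_le_mul' (esymmSpan_le R v k) le_rfl).trans ?_)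
  rw [mul_assoc, (Subalgebra.isIdempotentElem_toSubmodule _).eq]

/-- The hypothesis trades the symmetric functions in k variables, times the powers of the new
variable, for `Y k` and the symmetric functions in k + 1 variables; the factors `Y j` accumulate. -/
theorem adjoin_le_prod_mul {Y : ℕ → Submodule R A}
    (hY : ∀ k, Subalgebra.toSubmodule (esymmAdjoin R v k) *
        Subalgebra.toSubmodule (Algebra.adjoin R {v k}) ≤
      Y k * Subalgebra.toSubmodule (esymmAdjoin R v (k + 1))) (k : ℕ) :
    Subalgebra.toSubmodule (Algebra.adjoin R {z | ∃ j < k, z = v j}) ≤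
      (∏ j ∈ Finset.range k, Y j) * Subalgebra.toSubmodule (esymmAdjoin R v k) := by
  induction k with
  | zero =>
    rw [Finset.range_zero, Finset.prod_empty, one_mul]
    refine Algebra.adjoin_le ?_
    rintro _ ⟨j, hj, -⟩
    exact absurd hj (Nat.not_lt_zero _)
  | succ k ih =>
    have e : {z | ∃ j < k + 1, z = v j} = {z | ∃ j < k, z = v j} ∪ {v k} := by
      ext z
      simp only [Set.mem_ofPred_eq, Set.mem_union, Set.mem_singleton_iff]
      constructor
      · rintro ⟨j, hj, rfl⟩
        rcases (Nat.lt_succ_iff.1 hj).eq_or_lt with rfl | h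
        · exact Or.inr rfl
        · exact Or.inl ⟨j, h, rfl⟩
      · rintro (⟨j, hj, rfl⟩ | rfl)
        · exact ⟨j, by omega, rfl⟩
        · exact ⟨k, by omega, rfl⟩
    rw [e, Algebra.adjoin_union_coe_submodule, Finset.prod_range_succ, mul_assoc]
    refine (mul_le_mul' ih le_rfl).trans ?_
    rw [mul_assoc]
    exact mul_le_mul' le_rfl (hY k)

/-- If `Y_j` is spanned by `f_j(0), …, f_j(j)`, then the products `∏_j f_j(p_j) ∏_i e_i^{T_i}`
span. -/
theorem span_prod_mul_eq_top {n : ℕ} (hv : Algebra.adjoin R {z | ∃ j < n, z = v j} = ⊤)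
    (f : ℕ → ℕ → A)
    (hY : ∀ k, Subalgebra.toSubmodule (esymmAdjoin R v k) *
        Subalgebra.toSubmodule (Algebra.adjoin R {v k}) ≤
      Submodule.span R {z | ∃ i ≤ k, z = f k i} *
        Subalgebra.toSubmodule (esymmAdjoin R v (k + 1))) :
    Submodule.span R (Set.range fun p : {p : ℕ → ℕ // ∀ j, p j ≤ j} × (Fin n →₀ ℕ) =>
      (∏ j ∈ Finset.range n, f j (p.1.1 j)) *
        ∏ i : Fin n, qe v 0 n (i.1 + 1) ^ p.2 i) = ⊤ := by
  set W := Submodule.span R (Set.range fun p : {p : ℕ → ℕ // ∀ j, p j ≤ j} × (Fin n →₀ ℕ) =>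
      (∏ j ∈ Finset.range n, f j (p.1.1 j)) *
        ∏ i : Fin n, qe v 0 n (i.1 + 1) ^ p.2 i) with hW
  have h := adjoin_le_prod_mul R v hY n
  rw [hv, Algebra.top_toSubmodule, top_le_iff, Submodule.prod_span] at h
  rw [← top_le_iff, ← h, Submodule.mul_le]
  intro a ha b hb
  rw [Subalgebra.mem_toSubmodule, esymmAdjoin, Algebra.adjoin_range_eq_range_aeval] at hb
  obtain ⟨b, rfl⟩ := hb
  change a * MvPolynomial.aeval _ b ∈ W
  induction ha using Submodule.span_induction with
  | mem a ha =>
    obtain ⟨g, hg, rfl⟩ := (Set.mem_finsetProd _ _ _).1 ha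
    choose! p hp hp' using fun j (hj : j ∈ Finset.range n) => hg hj
    -- The indices are known only for j < n; their extension by 0 keeps the bound for every j.
    have e : ∏ j ∈ Finset.range n, g j =
        ∏ j ∈ Finset.range n, f j (if j ∈ Finset.range n then p j else 0) :=
      Finset.prod_congr rfl fun j hj => by rw [hp' j hj, if_pos hj]
    rw [e]
    induction b using MvPolynomial.induction_on' with
    | monomial T r =>
      rw [MvPolynomial.aeval_monomial, ← Algebra.smul_def, mul_smul_comm]
      refine W.smul_mem _ (Submodule.subset_span
        ⟨⟨⟨fun j => if j ∈ Finset.range n then p j else 0, fun j => ?_⟩, T⟩, ?_⟩)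
      · dsimp only
        split_ifs with h
        · exact hp j h
        · exact Nat.zero_le _
      · simp only
        rw [Finsupp.prod_fintype _ _ fun i => pow_zero _]
    | add b c hb hc => rw [map_add, mul_add]; exact add_mem hb hc
  | zero => rw [zero_mul]; exact zero_mem _
  | add x y _ _ hx hy => rw [add_mul]; exact add_mem hx hy
  | smul c x _ hx => rw [smul_mul_assoc]; exact W.smul_mem _ hx

end ClassicalSpanning

/-! ### Leading forms: transfer of spanning and independence -/

section LeadingForms

variable {σ R : Type*} [CommRing R]

/-- The polynomials of degree less than `d`. -/
def lowDegree (σ R : Type*) [CommRing R] (d : ℕ) : Submodule R (MvPolynomial σ R) where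
  carrier := {f | ∀ m, d ≤ m.degree → coeff m f = 0}
  zero_mem' m _ := coeff_zero m
  add_mem' hf hg m hm := by rw [coeff_add, hf m hm, hg m hm, add_zero]
  smul_mem' c f hf m hm := by rw [coeff_smul, hf m hm, smul_zero]

theorem lowDegree_mono {d e : ℕ} (h : d ≤ e) : lowDegree σ R d ≤ lowDegree σ R e :=
  fun _ hf m hm => hf m (h.trans hm)

theorem mul_mem_lowDegree {d e : ℕ} {f g : MvPolynomial σ R} (hf : f ∈ lowDegree σ R d)
    (hg : g ∈ lowDegree σ R (e + 1)) : f * g ∈ lowDegree σ R (d + e) := by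
  classical
  intro m hm
  rw [coeff_mul]
  refine Finset.sum_eq_zero fun p hp => ?_
  rw [Finset.HasAntidiagonal.mem_antidiagonal] at hp
  by_cases h : d ≤ p.1.degree
  · rw [hf _ h, zero_mul]
  · rw [hg, mul_zero]
    rw [← hp, map_add] at hm
    omega

theorem isHomogeneous_mem_lowDegree {d : ℕ} {f : MvPolynomial σ R} (hf : f.IsHomogeneous d) :
    f ∈ lowDegree σ R (d + 1) := fun m hm => hf.coeff_eq_zero (by omega)

theorem exists_mem_lowDegree (f : MvPolynomial σ R) : ∃ d, f ∈ lowDegree σ R d := by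
  refine ⟨f.totalDegree + 1, fun m hm => ?_⟩
  by_contra h
  have := le_totalDegree (mem_support_iff.2 h)
  rw [Finsupp.degree_apply] at hm
  simp only [Finsupp.sum] at this
  omega

/-- `f` is the homogeneous component of degree `d` of `f'`, and all other components of `f'` are
of lower degree. -/
def IsLeadingForm (d : ℕ) (f f' : MvPolynomial σ R) : Prop :=
  f.IsHomogeneous d ∧ f' - f ∈ lowDegree σ R d

theorem IsLeadingForm.refl {d : ℕ} {f : MvPolynomial σ R} (hf : f.IsHomogeneous d) :
    IsLeadingForm d f f := ⟨hf, by rw [sub_self]; exact zero_mem _⟩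

theorem IsLeadingForm.mem {d : ℕ} {f f' : MvPolynomial σ R} (h : IsLeadingForm d f f') :
    f' ∈ lowDegree σ R (d + 1) := by
  rw [← sub_add_cancel f' f]
  exact add_mem (lowDegree_mono (Nat.le_succ d) h.2) (isHomogeneous_mem_lowDegree h.1)

theorem IsLeadingForm.mul {d e : ℕ} {f f' g g' : MvPolynomial σ R} (hf : IsLeadingForm d f f')
    (hg : IsLeadingForm e g g') : IsLeadingForm (d + e) (f * g) (f' * g') := by
  refine ⟨hf.1.mul hg.1, ?_⟩
  have e1 : f' * g' - f * g = (f' - f) * g' + (g' - g) * f := by ring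
  rw [e1]
  refine add_mem (mul_mem_lowDegree hf.2 hg.mem) ?_
  rw [add_comm]
  exact mul_mem_lowDegree hg.2 (isHomogeneous_mem_lowDegree hf.1)

theorem IsLeadingForm.prod {ι : Type*} (s : Finset ι) {d : ι → ℕ} {f f' : ι → MvPolynomial σ R}
    (h : ∀ i ∈ s, IsLeadingForm (d i) (f i) (f' i)) :
    IsLeadingForm (∑ i ∈ s, d i) (∏ i ∈ s, f i) (∏ i ∈ s, f' i) := by
  classical
  induction s using Finset.induction_on with
  | empty => exact IsLeadingForm.refl (isHomogeneous_one _ _)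
  | insert a s ha ih =>
    rw [Finset.sum_insert ha, Finset.prod_insert ha, Finset.prod_insert ha]
    exact (h a (Finset.mem_insert_self a s)).mul
      (ih fun i hi => h i (Finset.mem_insert_of_mem hi))

theorem IsLeadingForm.pow {d : ℕ} {f f' : MvPolynomial σ R} (h : IsLeadingForm d f f') (m : ℕ) :
    IsLeadingForm (m * d) (f ^ m) (f' ^ m) := by
  have := IsLeadingForm.prod (Finset.range m) (d := fun _ => d) fun _ _ => h
  simpa using this

/-- In the recursion for e_{i+2} the quantum term q_k e_i has degree at most i, since q has degree
0. -/
theorem isLeadingForm_qe {v q : ℕ → MvPolynomial σ R} (hv : ∀ j, (v j).IsHomogeneous 1)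
    (hq : ∀ j, (q j).IsHomogeneous 0) (k i : ℕ) :
    IsLeadingForm i (qe v 0 k i) (qe v q k i) := by
  induction k using Nat.strong_induction_on generalizing i with
  | _ k ih =>
    match k, i with
    | k, 0 =>
      rw [qe_zero_right, qe_zero_right]
      exact IsLeadingForm.refl (isHomogeneous_one _ _)
    | 0, i + 1 =>
      rw [qe_of_lt _ _ (Nat.succ_pos i), qe_of_lt _ _ (Nat.succ_pos i)]
      exact IsLeadingForm.refl (isHomogeneous_zero _ _ _)
    | 1, 1 => rw [qe, qe]; exact IsLeadingForm.refl (hv 0)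
    | 1, i + 2 =>
      rw [qe, qe]
      exact IsLeadingForm.refl (isHomogeneous_zero _ _ _)
    | k + 2, 1 =>
      have h := ih (k + 1) (by omega) 1
      rw [qe, qe]
      refine ⟨h.1.add (hv _), ?_⟩
      rw [add_sub_add_right_eq_sub]
      exact h.2
    | k + 2, i + 2 =>
      have h1 := ih (k + 1) (by omega) (i + 2)
      have h2 := (IsLeadingForm.refl (hv (k + 1))).mul (ih (k + 1) (by omega) (i + 1))
      have h3 := (IsLeadingForm.refl (hq k)).mul (ih k (by omega) i)
      rw [show 1 + (i + 1) = i + 2 by omega] at h2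
      rw [zero_add] at h3
      rw [qe_succ_succ_zero, qe]
      refine ⟨h1.1.add h2.1, ?_⟩
      rw [add_sub_right_comm, add_sub_add_comm]
      exact add_mem (add_mem h1.2 h2.2) (lowDegree_mono (by omega) h3.mem)

theorem homogeneousComponent_eq_zero_of_mem_lowDegree {d N : ℕ} (h : d ≤ N)
    {f : MvPolynomial σ R} (hf : f ∈ lowDegree σ R d) : homogeneousComponent N f = 0 := by
  ext m
  rw [coeff_homogeneousComponent, coeff_zero]
  split_ifs with hm
  · exact hf m (hm ▸ h)
  · rfl

theorem sub_homogeneousComponent_mem {N : ℕ} {f : MvPolynomial σ R}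
    (hf : f ∈ lowDegree σ R (N + 1)) : f - homogeneousComponent N f ∈ lowDegree σ R N := by
  intro m hm
  rw [coeff_sub, coeff_homogeneousComponent]
  split_ifs with h
  · exact sub_self _
  · rw [sub_zero]
    exact hf m (lt_of_le_of_ne hm (Ne.symm h))

variable {ι : Type*} {d : ι → ℕ} {b b' : ι → MvPolynomial σ R}

/-- Induction on the degree: the top component of f is a combination of the b_i of that degree, and
replacing these by b'_i changes f only in lower degrees. -/
theorem span_eq_top_of_isLeadingForm (h : ∀ i, IsLeadingForm (d i) (b i) (b' i))
    (hb : Submodule.span R (Set.range b) = ⊤) : Submodule.span R (Set.range b') = ⊤ := by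
  classical
  have key : ∀ N, lowDegree σ R N ≤ Submodule.span R (Set.range b') := by
    intro N
    induction N with
    | zero =>
      intro f hf
      have : f = 0 := by
        ext m
        exact hf m (Nat.zero_le _)
      rw [this]
      exact zero_mem _
    | succ N ih =>
      intro f hf
      obtain ⟨c, hc⟩ := Finsupp.mem_span_range_iff_exists_finsupp.1
        (hb ▸ Submodule.mem_top : f ∈ Submodule.span R (Set.range b))
      have hN : homogeneousComponent N f = ∑ i ∈ c.support with d i = N, c i • b i := by
        rw [← hc, Finsupp.sum, map_sum, Finset.sum_filter]
        refine Finset.sum_congr rfl fun i _ => ?_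
        rw [map_smul, homogeneousComponent_of_mem (h i).1]
        simp only [eq_comm (a := N)]
        split_ifs
        · rfl
        · rw [smul_zero]
      have hsplit : f = ((f - homogeneousComponent N f) -
          ∑ i ∈ c.support with d i = N, c i • (b' i - b i)) +
            ∑ i ∈ c.support with d i = N, c i • b' i := by
        rw [hN]
        simp only [smul_sub, Finset.sum_sub_distrib]
        ring
      rw [hsplit]
      refine add_mem (ih (sub_mem (sub_homogeneousComponent_mem hf) (sum_mem fun i hi => ?_)))
        (sum_mem fun i _ => Submodule.smul_mem _ _ (Submodule.subset_span ⟨i, rfl⟩))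
      rw [Finset.mem_filter] at hi
      exact Submodule.smul_mem _ _ (hi.2 ▸ (h i).2)
  rw [← top_le_iff]
  intro f _
  obtain ⟨N, hN⟩ := exists_mem_lowDegree f
  exact key N hN

/-- In a nontrivial relation among the b'_i, the component of the largest degree that occurs is a
nontrivial relation among the b_i. -/
theorem linearIndependent_of_isLeadingForm (h : ∀ i, IsLeadingForm (d i) (b i) (b' i))
    (hb : LinearIndependent R b) : LinearIndependent R b' := by
  classical
  rw [linearIndependent_iff] at hb ⊢
  intro l hl
  by_contra hne
  obtain ⟨i, hi, hmax⟩ := Finset.exists_max_image l.support d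
    (Finsupp.support_nonempty_iff.2 hne)
  have h1 : Finsupp.linearCombination R b (l.filter fun j => d j = d i) = 0 := by
    have h2 := congrArg (homogeneousComponent (d i)) hl
    rw [Finsupp.linearCombination_apply, Finsupp.sum, map_sum, map_zero] at h2
    rw [Finsupp.linearCombination_apply, Finsupp.sum, Finsupp.support_filter, Finset.sum_filter]
    refine Eq.trans (Finset.sum_congr rfl fun j hj => ?_) h2
    rw [map_smul]
    split_ifs with hji
    · rw [Finsupp.filter_apply, if_pos hji]
      congr 1
      have h3 := homogeneousComponent_eq_zero_of_mem_lowDegree le_rfl (h j).2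
      rw [map_sub, homogeneousComponent_of_mem (h j).1, if_pos rfl, sub_eq_zero] at h3
      rw [← hji, h3]
    · rw [homogeneousComponent_eq_zero_of_mem_lowDegree _ (h j).mem, smul_zero]
      exact lt_of_le_of_ne (hmax j hj) hji
  have h2 := DFunLike.congr_fun (hb _ h1) i
  rw [Finsupp.filter_apply, if_pos rfl, Finsupp.zero_apply] at h2
  exact (Finsupp.mem_support_iff.1 hi) h2

end LeadingForms

/-! ### Staircase monomials as a basis of the quotient -/

section QuotientBasis

variable (n : ℕ) (R : Type*) [CommRing R]

/-- The variables `x_0, …, x_{n-1}`, continued by zero. -/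
noncomputable def xs (j : ℕ) : MvPolynomial (Fin n) R := if h : j < n then X ⟨j, h⟩ else 0

variable {n R}

theorem xs_of_lt {j : ℕ} (h : j < n) : xs n R j = X ⟨j, h⟩ := dif_pos h

theorem isHomogeneous_xs (j : ℕ) : (xs n R j).IsHomogeneous 1 := by
  rw [xs]
  split_ifs
  · exact isHomogeneous_X _ _
  · exact isHomogeneous_zero _ _ _

theorem adjoin_xs : Algebra.adjoin R {z | ∃ j < n, z = xs n R j} = ⊤ := by
  rw [← top_le_iff, ← adjoin_range_X]
  refine Algebra.adjoin_mono ?_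
  rintro _ ⟨j, rfl⟩
  exact ⟨j.1, j.2, (xs_of_lt j.2).symm⟩

theorem adjoin_xs_rev : Algebra.adjoin R {z | ∃ j < n, z = xs n R (n - 1 - j)} = ⊤ := by
  rw [← top_le_iff, ← adjoin_xs]
  refine Algebra.adjoin_mono ?_
  rintro _ ⟨j, hj, rfl⟩
  exact ⟨n - 1 - j, by omega, by congr 1; omega⟩

theorem qe_xs_zero (i : ℕ) : qe (xs n R) 0 n i = esymm (Fin n) R i := by
  rw [qe_zero_eq_esymm_fin, esymm_eq_multiset_esymm]
  congr 1
  exact Multiset.map_congr rfl fun j _ => xs_of_lt j.2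

theorem isLeadingForm_qe_xs (q : ℕ → R) (k i : ℕ) :
    IsLeadingForm i (qe (xs n R) 0 k i) (qe (xs n R) (fun j => C (q j)) k i) :=
  isLeadingForm_qe isHomogeneous_xs (fun _ => isHomogeneous_C _ _) k i

/-- The products `∏_{k<n} e_{p_k}(x_1, …, x_k) ∏_i e_i(x_1, …, x_n)^{T_i}` span. -/
theorem span_qe_products (q : ℕ → R) :
    Submodule.span R (Set.range fun p : {p : ℕ → ℕ // ∀ j, p j ≤ j} × (Fin n →₀ ℕ) =>
      (∏ j ∈ Finset.range n, qe (xs n R) (fun j => C (q j)) j (p.1.1 j)) *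
        ∏ i : Fin n, qe (xs n R) (fun j => C (q j)) n (i.1 + 1) ^ p.2 i) = ⊤ := by
  refine span_eq_top_of_isLeadingForm
    (d := fun p => ∑ j ∈ Finset.range n, p.1.1 j + ∑ i : Fin n, p.2 i * (i.1 + 1))
    (fun p => ?_) (span_prod_mul_eq_top R (xs n R) adjoin_xs
    (qe (xs n R) 0) (esymmAdjoin_mul_adjoin_le R (xs n R)))
  exact (IsLeadingForm.prod _ fun j _ => isLeadingForm_qe_xs q j _).mul
    (IsLeadingForm.prod _ fun i _ => (isLeadingForm_qe_xs q n _).pow _)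

/-- The exponents of the staircase monomials. -/
abbrev Stair (n : ℕ) : Type := {a : Fin n →₀ ℕ // a ∈ Finset.Iic (stair n)}

/-- The products of a staircase monomial and a monomial in quantum elementary polynomials. -/
noncomputable def stairFamily (q : ℕ → R) (p : Stair n × (Fin n →₀ ℕ)) : MvPolynomial (Fin n) R :=
  monomial p.1.1 1 * ∏ i : Fin n, qe (xs n R) (fun j => C (q j)) n (i.1 + 1) ^ p.2 i

theorem isLeadingForm_stairFamily (q : ℕ → R) (p : Stair n × (Fin n →₀ ℕ)) :
    IsLeadingForm (p.1.1.degree + ∑ i : Fin n, p.2 i * (i.1 + 1))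
      (stairFamily (0 : ℕ → R) p) (stairFamily q p) := by
  have h0 : (fun j => C ((0 : ℕ → R) j)) = (0 : ℕ → MvPolynomial (Fin n) R) :=
    funext fun j => map_zero C
  rw [stairFamily, stairFamily, h0]
  exact (IsLeadingForm.refl (isHomogeneous_monomial _ rfl)).mul
    (IsLeadingForm.prod _ fun i _ => (isLeadingForm_qe_xs q n _).pow _)

/-- For q = 0 the variables are adjoined in reverse order, so that the bound p_j ≤ j for x_{n-1-j}
becomes the staircase bound. -/
theorem span_stairFamily (q : ℕ → R) : Submodule.span R (Set.range (stairFamily (n := n) q)) = ⊤ := by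
  refine span_eq_top_of_isLeadingForm (isLeadingForm_stairFamily q) ?_
  rw [← top_le_iff, ← span_prod_mul_eq_top R (fun j => xs n R (n - 1 - j)) adjoin_xs_rev
    (fun k i => xs n R (n - 1 - k) ^ i) (esymmAdjoin_mul_adjoin_le_powSpan R _)]
  refine Submodule.span_mono ?_
  rintro _ ⟨⟨p, T⟩, rfl⟩
  let a : Fin n →₀ ℕ := Finsupp.equivFunOnFinite.symm fun j => p.1 (n - 1 - j.1)
  refine ⟨⟨⟨a, ?_⟩, T⟩, ?_⟩
  · rw [Finset.mem_Iic]
    exact fun j => p.2 _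
  · have h0 : (fun j => C ((0 : ℕ → R) j)) = (0 : ℕ → MvPolynomial (Fin n) R) :=
      funext fun j => map_zero C
    rw [stairFamily, h0]
    simp only [qe_zero_rev]
    congr 1
    rw [monomial_eq, map_one, one_mul, Finsupp.prod_fintype _ _ fun i => pow_zero _,
      ← Fin.prod_univ_eq_prod_range (fun j => xs n R (n - 1 - j) ^ p.1 j) n]
    refine Fintype.prod_equiv Fin.revPerm _ _ fun j => ?_
    have h1 : n - 1 - (Fin.revPerm j).1 = j.1 := by
      rw [Fin.revPerm_apply, Fin.val_rev]; omega
    have h2 : (Fin.revPerm j).1 = n - 1 - j.1 := by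
      rw [Fin.revPerm_apply, Fin.val_rev]; omega
    rw [h1, xs_of_lt j.2, h2]
    rfl

/-- The operators L_b extracting the staircase coefficients are linear over symmetric polynomials.
The matrix of the L_b(x^a) has the identity as its constant part, so its determinant is non-zero,
and it annihilates the coefficient vector of any relation. -/
theorem linearIndependent_stair_symmetric [IsDomain R] :
    LinearIndependent (symmetricSubalgebra (Fin n) R)
      (fun a : Stair n => (monomial a.1 1 : MvPolynomial (Fin n) R)) := by
  classical
  choose N hN using fun b : Stair n => exists_coeff_eq_sum_divDiffPerm (Finset.mem_Iic.1 b.2)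
  let L : Stair n → MvPolynomial (Fin n) R →ₗ[R] MvPolynomial (Fin n) R :=
    fun b => ∑ v, N b v • divDiffPermLin R v
  have hL : ∀ (b : Stair n) {s : MvPolynomial (Fin n) R}, s.IsSymmetric →
      ∀ f, L b (s * f) = s * L b f := by
    intro b s hs f
    simp only [L, LinearMap.sum_apply, LinearMap.smul_apply, divDiffPermLin_apply,
      divDiffPerm_symm_mul _ hs, Finset.mul_sum, mul_smul_comm]
  let P : Matrix (Stair n) (Stair n) (MvPolynomial (Fin n) R) :=
    Matrix.of fun b a => L b (monomial a.1 1)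
  have hP : (constantCoeff (σ := Fin n) (R := R)).mapMatrix P = 1 := by
    ext b a
    rw [RingHom.mapMatrix_apply, Matrix.map_apply, Matrix.one_apply]
    have := hN b R a.1 (Finset.mem_Iic.1 a.2)
    simp only [P, L, Matrix.of_apply, LinearMap.sum_apply, LinearMap.smul_apply,
      divDiffPermLin_apply, map_sum, constantCoeff_smul]
    simp only [zsmul_eq_mul, this, Subtype.coe_inj, eq_comm (a := a)]
  have hdet : P.det ≠ 0 := by
    intro h
    have h1 := congrArg constantCoeff h
    rw [RingHom.map_det, hP, Matrix.det_one, map_zero] at h1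
    exact one_ne_zero h1
  rw [Fintype.linearIndependent_iff]
  intro g hg a
  have hv : P.mulVec (fun a => (g a : MvPolynomial (Fin n) R)) = 0 := by
    funext b
    have h1 := congrArg (L b) hg
    rw [map_sum, map_zero] at h1
    rw [Pi.zero_apply, ← h1, Matrix.mulVec, dotProduct]
    refine Finset.sum_congr rfl fun a _ => ?_
    rw [Subalgebra.smul_def, smul_eq_mul, hL b (g a).2, mul_comm]
    rfl
  exact Subtype.ext (congrFun (Matrix.eq_zero_of_mulVec_eq_zero hdet hv) a)

/-- After passing to q = 0, the e_i are algebraically independent generators of the symmetric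
polynomials, over which the staircase monomials are independent; products of the two families are
independent over R. -/
theorem linearIndependent_stairFamily [IsDomain R] (q : ℕ → R) :
    LinearIndependent R (stairFamily (n := n) q) := by
  refine linearIndependent_of_isLeadingForm (isLeadingForm_stairFamily q) ?_
  have hb : LinearIndependent R fun T : Fin n →₀ ℕ =>
      esymmAlgEquiv (Fin n) R (Fintype.card_fin n) (monomial T 1) := by
    have := (basisMonomials (Fin n) R).linearIndependent.map'
      (esymmAlgEquiv (Fin n) R (Fintype.card_fin n)).toLinearMap
      (LinearMap.ker_eq_bot.2 (esymmAlgEquiv (Fin n) R (Fintype.card_fin n)).injective)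
    simpa [Function.comp_def] using this
  have h := (linearIndependent_smul hb linearIndependent_stair_symmetric).comp Prod.swap
    Prod.swap_injective
  convert h using 1
  funext p
  have h0 : (fun j => C ((0 : ℕ → R) j)) = (0 : ℕ → MvPolynomial (Fin n) R) :=
    funext fun j => map_zero C
  have h1 : ((esymmAlgEquiv (Fin n) R (Fintype.card_fin n) (monomial p.2 1) :
      symmetricSubalgebra (Fin n) R) : MvPolynomial (Fin n) R) =
      ∏ i : Fin n, qe (xs n R) 0 n (i.1 + 1) ^ p.2 i := by
    change ((esymmAlgHom (Fin n) R n (monomial p.2 1) : symmetricSubalgebra (Fin n) R) :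
      MvPolynomial (Fin n) R) = _
    rw [esymmAlgHom_apply, aeval_monomial, map_one, one_mul,
      Finsupp.prod_fintype _ _ fun i => pow_zero _]
    simp only [qe_xs_zero]
  rw [stairFamily, h0, ← h1, mul_comm]
  rfl

/-- The ideal generated by the quantum elementary polynomials of positive degree. -/
noncomputable def elemIdeal (n : ℕ) (q : ℕ → R) : Ideal (MvPolynomial (Fin n) R) :=
  Ideal.span {e | ∃ i : ℕ, 1 ≤ i ∧ i ≤ n ∧ e = qe (xs n R) (fun j => C (q j)) n i}

theorem qe_mem_elemIdeal (q : ℕ → R) (i : Fin n) :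
    qe (xs n R) (fun j => C (q j)) n (i.1 + 1) ∈ elemIdeal n q :=
  Ideal.subset_span ⟨i.1 + 1, Nat.succ_le_succ (Nat.zero_le _), i.2, rfl⟩

/-- A spanning product with T ≠ 0 has a generator of the ideal as a factor. -/
theorem mem_span_sup_elemIdeal {q : ℕ → R} {ι : Type*} {u : ι → MvPolynomial (Fin n) R}
    (h : Submodule.span R (Set.range fun p : ι × (Fin n →₀ ℕ) =>
      u p.1 * ∏ i : Fin n, qe (xs n R) (fun j => C (q j)) n (i.1 + 1) ^ p.2 i) = ⊤)
    (f : MvPolynomial (Fin n) R) :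
    f ∈ Submodule.span R (Set.range u) ⊔ (elemIdeal n q).restrictScalars R := by
  suffices H : (⊤ : Submodule R (MvPolynomial (Fin n) R)) ≤
      Submodule.span R (Set.range u) ⊔ (elemIdeal n q).restrictScalars R from H Submodule.mem_top
  rw [← h, Submodule.span_le]
  rintro _ ⟨⟨a, T⟩, rfl⟩
  by_cases hT : T = 0
  · refine Submodule.mem_sup_left ?_
    simp only [hT, Finsupp.zero_apply, pow_zero, Finset.prod_const_one, mul_one]
    exact Submodule.subset_span ⟨a, rfl⟩
  · refine Submodule.mem_sup_right ?_
    obtain ⟨i, hi⟩ := Finsupp.ne_iff.1 hT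
    refine Ideal.mul_mem_left _ _ (Ideal.mem_of_dvd _ (Finset.dvd_prod_of_mem _
      (Finset.mem_univ i)) (Ideal.pow_mem_of_mem _ (qe_mem_elemIdeal q i) _
        (Nat.pos_of_ne_zero hi)))

theorem exists_stair_sub_mem (q : ℕ → R) (f : MvPolynomial (Fin n) R) :
    ∃ c : Stair n → R, f - ∑ a, c a • monomial a.1 1 ∈ elemIdeal n q := by
  obtain ⟨g, hg, h, hh, rfl⟩ := Submodule.mem_sup.1 (mem_span_sup_elemIdeal
    (u := fun a : Stair n => monomial a.1 1) (span_stairFamily q) f)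
  obtain ⟨c, rfl⟩ := (Submodule.mem_span_range_iff_exists_fun R).1 hg
  exact ⟨c, by rw [add_sub_cancel_left]; exact hh⟩

theorem elemIdeal_le_span (q : ℕ → R) {f : MvPolynomial (Fin n) R} (hf : f ∈ elemIdeal n q) :
    f ∈ Submodule.span R (stairFamily q '' {p : Stair n × (Fin n →₀ ℕ) | p.2 ≠ 0}) := by
  set W := Submodule.span R (stairFamily q '' {p : Stair n × (Fin n →₀ ℕ) | p.2 ≠ 0})
  -- Quantifying over all multiples lets the induction pass through ideal coefficients. A generator
  -- e_i times a member of the family is again a member, with T raised by one at index i - 1.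
  suffices H : ∀ z, z * f ∈ W by simpa using H 1
  induction hf using Submodule.span_induction with
  | mem e he =>
    obtain ⟨i, hi1, hi2, rfl⟩ := he
    intro z
    have hz : z ∈ Submodule.span R (Set.range (stairFamily q)) :=
      span_stairFamily (n := n) q ▸ Submodule.mem_top
    induction hz using Submodule.span_induction with
    | mem z hz =>
      obtain ⟨⟨a, T⟩, rfl⟩ := hz
      refine Submodule.subset_span ⟨⟨a, T + Finsupp.single ⟨i - 1, by omega⟩ 1⟩, ?_, ?_⟩
      · intro h
        have := DFunLike.congr_fun h ⟨i - 1, by omega⟩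
        simp at this
      · simp only [stairFamily, Finsupp.add_apply, pow_add, Finset.prod_mul_distrib, mul_assoc]
        congr 2
        rw [Finset.prod_eq_single ⟨i - 1, by omega⟩]
        · rw [Finsupp.single_eq_same, pow_one]
          congr 1
          simp only
          omega
        · intro j _ hj
          rw [Finsupp.single_eq_of_ne hj, pow_zero]
        · exact fun h => absurd (Finset.mem_univ _) h
    | zero => rw [zero_mul]; exact zero_mem _
    | add x y _ _ hx hy => rw [add_mul]; exact add_mem hx hy
    | smul c x _ hx => rw [smul_mul_assoc]; exact W.smul_mem _ hx
  | zero => intro z; rw [mul_zero]; exact zero_mem _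
  | add x y _ _ hx hy => intro z; rw [mul_add]; exact add_mem (hx z) (hy z)
  | smul c x _ hx =>
    intro z
    rw [smul_eq_mul, ← mul_assoc]
    exact hx _

/-- The staircase monomials are the basis elements with T = 0, while the ideal lies in the span of
those with T ≠ 0. -/
theorem stair_eq_zero_of_mem [IsDomain R] (q : ℕ → R) {c : Stair n → R}
    (h : ∑ a, c a • (monomial a.1 1 : MvPolynomial (Fin n) R) ∈ elemIdeal n q) : c = 0 := by
  have hli := linearIndependent_stairFamily (n := n) q
  have e : ∀ a : Stair n, stairFamily q (a, 0) = monomial a.1 1 := fun a => by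
    simp [stairFamily]
  have h1 : ∑ a, c a • (monomial a.1 1 : MvPolynomial (Fin n) R) ∈
      Submodule.span R (stairFamily q '' {p : Stair n × (Fin n →₀ ℕ) | p.2 = 0}) :=
    sum_mem fun a _ => Submodule.smul_mem _ _ (Submodule.subset_span ⟨(a, 0), rfl, e a⟩)
  have h2 := Submodule.disjoint_def.1 (hli.disjoint_span_image
    (s := {p | p.2 = 0}) (t := {p | p.2 ≠ 0})
    (Set.disjoint_left.2 fun p hp hp' => hp' hp)) _ h1 (elemIdeal_le_span q h)
  have h3 := hli.comp (fun a : Stair n => (a, 0)) fun a b hab => (Prod.ext_iff.1 hab).1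
  have h4 := Fintype.linearIndependent_iff.1 h3 c (by
    rw [← h2]
    exact Finset.sum_congr rfl fun a _ => by rw [Function.comp_apply, e])
  exact funext h4

end QuotientBasis

/-! ### The tridiagonal determinant -/

section Tridiagonal

variable {A : Type*} [CommRing A]

/-- Expansion along the last row leaves the entries x_{k+1} + t and -1; the minor belonging to -1 is
expanded along its last column, where only q_k remains. -/
theorem qDelta_add_two (x q : ℕ → A) (k : ℕ) (t : A) :
    qDelta x q (k + 2) t = (x (k + 1) + t) * qDelta x q (k + 1) t + q k * qDelta x q k t := by
  have hz : ∀ j : Fin k, (Matrix.of fun i j : Fin (k + 2) =>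
      if i = j then x i + t else if i.1 + 1 = j.1 then q i else if j.1 + 1 = i.1 then -1 else 0)
        (Fin.last (k + 1)) j.castSucc.castSucc = 0 := by
    intro j
    have := j.2
    rw [Matrix.of_apply, if_neg, if_neg, if_neg] <;>
      simp only [Fin.ext_iff, Fin.val_last, Fin.val_castSucc] <;> omega
  have hz' : ∀ i : Fin k, (Matrix.of fun i j : Fin (k + 2) =>
      if i = j then x i + t else if i.1 + 1 = j.1 then q i else if j.1 + 1 = i.1 then -1 else 0)
        i.castSucc.castSucc (Fin.last (k + 1)) = 0 := by
    intro j
    have := j.2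
    rw [Matrix.of_apply, if_neg, if_neg, if_neg] <;>
      simp only [Fin.ext_iff, Fin.val_last, Fin.val_castSucc] <;> omega
  have hs : (Fin.castSucc (Fin.last k)).succAbove (Fin.last k) = Fin.last (k + 1) := by
    simp
  have hs' : ∀ j : Fin k, (Fin.castSucc (Fin.last k)).succAbove j.castSucc =
      j.castSucc.castSucc := fun j =>
    Fin.succAbove_of_castSucc_lt _ _ (Fin.castSucc_lt_castSucc_iff.2 (Fin.castSucc_lt_last j))
  rw [qDelta, Matrix.det_succ_row _ (Fin.last (k + 1)), Fin.sum_univ_castSucc,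
    Fin.sum_univ_castSucc, Finset.sum_eq_zero fun j _ => by rw [hz j, mul_zero, zero_mul], zero_add,
    Matrix.det_succ_column (Matrix.submatrix _ _ (Fin.castSucc (Fin.last k)).succAbove)
      (Fin.last k), Fin.sum_univ_castSucc, Finset.sum_eq_zero fun j _ => by
      rw [Matrix.submatrix_apply, hs, Fin.succAbove_last, hz' j, mul_zero, zero_mul], zero_add]
  have e1 : (Matrix.submatrix (Matrix.of fun i j : Fin (k + 2) =>
      if i = j then x i + t else if i.1 + 1 = j.1 then q i else if j.1 + 1 = i.1 then -1 else 0)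
        (Fin.last (k + 1)).succAbove (Fin.last (k + 1)).succAbove).det = qDelta x q (k + 1) t := by
    rw [qDelta]
    congr 1
    ext i j
    simp [Fin.ext_iff]
  have e2 : (Matrix.submatrix (Matrix.submatrix (Matrix.of fun i j : Fin (k + 2) =>
      if i = j then x i + t else if i.1 + 1 = j.1 then q i else if j.1 + 1 = i.1 then -1 else 0)
        (Fin.last (k + 1)).succAbove (Fin.castSucc (Fin.last k)).succAbove)
        (Fin.last k).succAbove (Fin.last k).succAbove).det = qDelta x q k t := by
    rw [qDelta]
    congr 1
    ext i j
    simp [Fin.ext_iff, hs']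
  rw [e1, e2, Matrix.submatrix_apply, hs, Fin.succAbove_last]
  have s1 : (-1 : A) ^ (k + 1 + k) = -1 := by
    rw [show k + 1 + k = 2 * k + 1 by ring, pow_succ, pow_mul]; simp
  have s2 : (-1 : A) ^ (k + k) = 1 := by
    rw [← two_mul, pow_mul]; simp
  have s3 : (-1 : A) ^ (k + 1 + (k + 1)) = 1 := by
    rw [← two_mul, pow_mul]; simp
  simp only [Matrix.of_apply, Fin.val_last, Fin.val_castSucc, Fin.ext_iff, s1, s2, s3,
    Nat.succ_ne_self, if_true, if_false]
  rw [if_neg (by omega), if_neg (by omega)]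
  ring

theorem qDelta_eq_sum (x q : ℕ → A) (k : ℕ) (t : A) :
    qDelta x q k t = ∑ i ∈ Finset.range (k + 1), qe x q k i * t ^ (k - i) := by
  induction k using Nat.strong_induction_on with
  | _ k ih =>
    match k with
    | 0 => simp [qDelta, qe]
    | 1 => simp [qDelta, qe, Finset.sum_range_succ, add_comm]
    | k + 2 =>
      have h1 : ∑ i ∈ Finset.range (k + 1), q k * qe x q k i * t ^ (k - i) =
          q k * qDelta x q k t := by
        rw [ih k (by omega), Finset.mul_sum]
        exact Finset.sum_congr rfl fun i _ => mul_assoc _ _ _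
      have h2 : ∑ i ∈ Finset.range (k + 2), x (k + 1) * qe x q (k + 1) i * t ^ (k + 1 - i) =
          x (k + 1) * qDelta x q (k + 1) t := by
        rw [ih (k + 1) (by omega), Finset.mul_sum]
        exact Finset.sum_congr rfl fun i _ => mul_assoc _ _ _
      have h3 : ∑ i ∈ Finset.range (k + 2), qe x q (k + 1) i * t ^ (k + 2 - i) =
          t * qDelta x q (k + 1) t := by
        rw [ih (k + 1) (by omega), Finset.mul_sum]
        refine Finset.sum_congr rfl fun i hi => ?_
        rw [Finset.mem_range] at hi
        rw [show k + 2 - i = k + 1 - i + 1 by omega, pow_succ]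
        ring
      have h4 : ∀ i, qe x q (k + 2) (i + 1) = qe x q (k + 1) (i + 1) +
          x (k + 1) * qe x q (k + 1) i + (if i = 0 then 0 else q k * qe x q k (i - 1)) := by
        rintro (_ | i)
        · rw [if_pos rfl, zero_add, qe_succ_one, qe_zero_right, mul_one, add_zero]
        · rw [if_neg (Nat.succ_ne_zero i), qe, Nat.add_sub_cancel]
      have h5 : ∑ i ∈ Finset.range (k + 2),
          (if i = 0 then 0 else q k * qe x q k (i - 1)) * t ^ (k + 2 - (i + 1)) =
          ∑ i ∈ Finset.range (k + 1), q k * qe x q k i * t ^ (k - i) := by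
        rw [Finset.sum_range_succ' _ (k + 1), if_pos rfl, zero_mul, add_zero]
        refine Finset.sum_congr rfl fun i _ => ?_
        rw [if_neg (Nat.succ_ne_zero i), Nat.add_sub_cancel,
          show k + 2 - (i + 1 + 1) = k - i by omega]
      -- The two sums agree after a shift because e_0 = 1 for every number of variables and e_{k+2}
      -- vanishes in k + 1 variables.
      have h6 : ∑ i ∈ Finset.range (k + 2), qe x q (k + 1) (i + 1) * t ^ (k + 2 - (i + 1)) +
          qe x q (k + 2) 0 * t ^ (k + 2 - 0) =
          ∑ i ∈ Finset.range (k + 2), qe x q (k + 1) i * t ^ (k + 2 - i) := by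
        rw [qe_zero_right, ← qe_zero_right x q (k + 1),
          ← Finset.sum_range_succ' (fun i => qe x q (k + 1) i * t ^ (k + 2 - i)) (k + 2),
          Finset.sum_range_succ _ (k + 2), qe_of_lt _ _ (Nat.lt_succ_self (k + 1)), zero_mul,
          add_zero]
      have h7 : ∀ i, k + 2 - (i + 1) = k + 1 - i := fun i => by omega
      rw [qDelta_add_two, add_mul, ← h1, ← h2, ← h3, ← h6, ← h5, Finset.sum_range_succ' _ (k + 2)]
      simp only [h4, h7, add_mul, Finset.sum_add_distrib]
      ring

theorem coeff_qDelta (x q : ℕ → A) {k i : ℕ} (h : i ≤ k) :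
    (qDelta (fun j => Polynomial.C (x j)) (fun j => Polynomial.C (q j)) k Polynomial.X).coeff
      (k - i) = qe x q k i := by
  rw [qDelta_eq_sum, Polynomial.finsetSum_coeff, Finset.sum_eq_single i]
  · have := map_qe (Polynomial.C) x q k i
    rw [Function.comp_def, Function.comp_def] at this
    rw [← this, Polynomial.coeff_C_mul_X_pow, if_pos rfl]
  · intro j hj hji
    have := map_qe (Polynomial.C) x q k j
    rw [Function.comp_def, Function.comp_def] at this
    rw [Finset.mem_range] at hj
    rw [← this, Polynomial.coeff_C_mul_X_pow, if_neg (by omega)]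
  · intro hi
    rw [Finset.mem_range] at hi
    omega

theorem qElem_eq_qe (n : ℕ) {k i : ℕ} (h : i ≤ k) : qElem n k i = qe (xVar n) (qVar n) k i :=
  coeff_qDelta _ _ h

end Tridiagonal

/-! ### The ideal in ℤ[x, q], viewed over the coefficient ring ℤ[q] -/

section Transport

variable {n : ℕ} {R : Type*} [CommRing R]

/-- An isomorphism carrying the variables to the variables carries the ideal generated by the
quantum elementary polynomials to `elemIdeal`. -/
theorem mem_elemIdeal_iff {B : Type*} [CommRing B] (Φ : B ≃+* MvPolynomial (Fin n) R)
    {x q : ℕ → B} {q' : ℕ → R} (hx : ∀ j, Φ (x j) = xs n R j) (hq : ∀ j, Φ (q j) = C (q' j))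
    (f : B) :
    f ∈ Ideal.span {e | ∃ i : ℕ, 1 ≤ i ∧ i ≤ n ∧ e = qe x q n i} ↔ Φ f ∈ elemIdeal n q' := by
  have hqe : ∀ i, Φ (qe x q n i) = qe (xs n R) (fun j => C (q' j)) n i := by
    intro i
    have := map_qe (Φ : B →+* MvPolynomial (Fin n) R) x q n i
    rw [RingEquiv.coe_toRingHom] at this
    rw [this]
    congr 1
    · exact funext hx
    · exact funext hq
  have himage : (Φ : B →+* MvPolynomial (Fin n) R) ''
      {e | ∃ i : ℕ, 1 ≤ i ∧ i ≤ n ∧ e = qe x q n i} =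
      {e | ∃ i : ℕ, 1 ≤ i ∧ i ≤ n ∧ e = qe (xs n R) (fun j => C (q' j)) n i} := by
    ext z
    constructor
    · rintro ⟨_, ⟨i, h1, h2, rfl⟩, rfl⟩
      exact ⟨i, h1, h2, hqe i⟩
    · rintro ⟨i, h1, h2, rfl⟩
      exact ⟨_, ⟨i, h1, h2, rfl⟩, hqe i⟩
  rw [elemIdeal, ← himage, ← Ideal.map_span]
  constructor
  · exact fun h => Ideal.mem_map_of_mem _ h
  · intro h
    obtain ⟨g, hg, hgf⟩ := (Ideal.mem_map_iff_of_surjective _ Φ.surjective).1 h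
    rwa [← Φ.injective hgf]

theorem qIdeal_eq_span (n : ℕ) :
    qIdeal n = Ideal.span {e | ∃ i : ℕ, 1 ≤ i ∧ i ≤ n ∧ e = qe (xVar n) (qVar n) n i} := by
  rw [qIdeal]
  congr 1
  ext e
  constructor <;> rintro ⟨i, h1, h2, rfl⟩
  · exact ⟨i, h1, h2, qElem_eq_qe n h2⟩
  · exact ⟨i, h1, h2, (qElem_eq_qe n h2).symm⟩

/-- The variables `q_0, …, q_{n-2}` of `ℤ[q]`, continued by zero. -/
noncomputable def qCoeff (n : ℕ) (j : ℕ) : MvPolynomial (Fin (n - 1)) ℤ :=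
  if h : j < n - 1 then X ⟨j, h⟩ else 0

/-- `ℤ[x, q]` as the polynomial ring in `x` over `ℤ[q]`. -/
noncomputable def xqEquiv (n : ℕ) :
    XQ n ≃ₐ[ℤ] MvPolynomial (Fin n) (MvPolynomial (Fin (n - 1)) ℤ) :=
  sumAlgEquiv ℤ (Fin n) (Fin (n - 1))

theorem xqEquiv_xVar (j : ℕ) : xqEquiv n (xVar n j) = xs n _ j := by
  rw [xVar, xs]
  split_ifs
  · exact sumAlgEquiv_X_inl ..
  · exact map_zero _

theorem xqEquiv_qVar (j : ℕ) : xqEquiv n (qVar n j) = C (qCoeff n j) := by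
  rw [qVar, qCoeff]
  split_ifs
  · exact sumAlgEquiv_X_inr ..
  · rw [map_zero, map_zero]

theorem xqEquiv_rename_inr (c : MvPolynomial (Fin (n - 1)) ℤ) :
    xqEquiv n (rename Sum.inr c) = C c :=
  DFunLike.congr_fun (sumAlgEquiv_comp_rename_inr ℤ (Fin n) (Fin (n - 1))) c

theorem mem_qIdeal_iff (f : XQ n) : f ∈ qIdeal n ↔ xqEquiv n f ∈ elemIdeal n (qCoeff n) := by
  rw [qIdeal_eq_span]
  exact mem_elemIdeal_iff (xqEquiv n).toRingEquiv xqEquiv_xVar xqEquiv_qVar f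

end Transport

/-! ### Quantum Schubert polynomials as a basis; structure constants -/

section SchubertSpan

variable {n : ℕ}

/-- The exponent in `y` of the term of the top double polynomial indexed by `p`. -/
noncomputable def topExponent (p : Fin (n - 1) → ℕ) : Fin n →₀ ℕ :=
  ∑ i : Fin (n - 1), Finsupp.single (⟨n - 2 - i.1, by omega⟩ : Fin n) (i.1 + 1 - p i)

theorem topExponent_apply (p : Fin (n - 1) → ℕ) (i : Fin (n - 1)) :
    topExponent p ⟨n - 2 - i.1, by omega⟩ = i.1 + 1 - p i := by
  rw [topExponent, Finsupp.finsetSum_apply, Finset.sum_eq_single i]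
  · exact Finsupp.single_eq_same
  · intro j _ hj
    refine Finsupp.single_eq_of_ne fun h => hj (Fin.ext ?_)
    have := congrArg Fin.val h
    have h1 := i.2
    have h2 := j.2
    simp only at this
    omega
  · exact fun h => absurd (Finset.mem_univ _) h

theorem topExponent_le (p : Fin (n - 1) → ℕ) : topExponent p ≤ stair n := by
  intro j
  rw [stair_apply]
  by_cases h : j.1 < n - 1
  · have := topExponent_apply p ⟨n - 2 - j.1, by omega⟩
    have e : (⟨n - 2 - (n - 2 - j.1), by omega⟩ : Fin n) = j := Fin.ext (by simp only; omega)
    simp only [e] at this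
    rw [this]
    omega
  · rw [topExponent, Finsupp.finsetSum_apply, Finset.sum_eq_zero]
    · exact Nat.zero_le _
    · intro i _
      refine Finsupp.single_eq_of_ne fun h' => h ?_
      rw [h']
      have := i.2
      simp only
      omega

theorem qDoubleTop_eq_sum (n : ℕ) : qDoubleTop n =
    ∑ p ∈ Fintype.piFinset fun i : Fin (n - 1) => Finset.range (i.1 + 2),
      (∏ i : Fin (n - 1), qe (xVar n) (qVar n) (i.1 + 1) (p i)) • monomial (topExponent p) 1 := by
  rw [qDoubleTop]
  simp only [qDelta_eq_sum]
  rw [Finset.prod_univ_sum]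
  refine Finset.sum_congr rfl fun p _ => ?_
  rw [Finset.prod_mul_distrib, smul_eq_C_mul, map_prod, topExponent, monomial_sum_one]
  congr 1
  · refine Finset.prod_congr rfl fun i _ => ?_
    have := map_qe (C (σ := Fin n)) (xVar n) (qVar n) (i.1 + 1) (p i)
    rw [this]
    rfl
  · exact Finset.prod_congr rfl fun i _ => X_pow_eq_monomial

/-- The product is the coefficient of a staircase monomial in y of the top double polynomial, hence
an integral combination of the values at y = 0 of its divided differences. -/
theorem prod_qe_mem_span_qSchubert (p : Fin (n - 1) → ℕ) (hp : ∀ i, p i ≤ i.1 + 1) :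
    ∏ i : Fin (n - 1), qe (xVar n) (qVar n) (i.1 + 1) (p i) ∈
      Submodule.span ℤ (Set.range (qSchubert (n := n))) := by
  classical
  obtain ⟨N, hN⟩ := exists_coeff_eq_sum_divDiffPerm (topExponent_le p)
  have hpmem : p ∈ Fintype.piFinset fun i : Fin (n - 1) => Finset.range (i.1 + 2) := by
    rw [Fintype.mem_piFinset]
    exact fun i => Finset.mem_range.2 (Nat.lt_succ_of_le (hp i))
  have key : ∑ v, (N v : XQ n) * constantCoeff (divDiffPerm v (qDoubleTop n)) =
      ∏ i : Fin (n - 1), qe (xVar n) (qVar n) (i.1 + 1) (p i) := by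
    have h1 : ∀ v, constantCoeff (divDiffPerm v (qDoubleTop n)) =
        ∑ p ∈ Fintype.piFinset fun i : Fin (n - 1) => Finset.range (i.1 + 2),
          (∏ i : Fin (n - 1), qe (xVar n) (qVar n) (i.1 + 1) (p i)) *
            constantCoeff (divDiffPerm v (monomial (topExponent p) 1)) := by
      intro v
      rw [qDoubleTop_eq_sum, ← divDiffPermLin_apply, map_sum, map_sum]
      refine Finset.sum_congr rfl fun p _ => ?_
      rw [map_smul, constantCoeff_smul, smul_eq_mul, divDiffPermLin_apply]
    simp only [h1, Finset.mul_sum]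
    rw [Finset.sum_comm, Finset.sum_eq_single p]
    · rw [Finset.sum_congr rfl fun v _ => mul_left_comm _ _ _, ← Finset.mul_sum,
        hN _ _ (topExponent_le p), if_pos rfl, mul_one]
    · intro p' hp' hne
      rw [Finset.sum_congr rfl fun v _ => mul_left_comm _ _ _, ← Finset.mul_sum,
        hN _ _ (topExponent_le p'), if_neg, mul_zero]
      -- Within the box p_i ≤ i + 1 the truncated subtraction is exact, so the exponents i + 1 - p_i
      -- determine p.
      intro h
      refine hne (funext fun i => ?_)
      have h2 := DFunLike.congr_fun h ⟨n - 2 - i.1, by omega⟩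
      rw [topExponent_apply, topExponent_apply] at h2
      have h3 := Finset.mem_range.1 (Fintype.mem_piFinset.1 hp' i)
      have h4 := hp i
      omega
    · exact fun h => absurd hpmem h
  rw [← key]
  refine sum_mem fun v _ => ?_
  rw [← zsmul_eq_mul]
  -- Since S_w is defined by ∂_{w w_0}, the operator ∂_v belongs to w = v w_0, as w_0² = 1.
  refine Submodule.smul_mem _ _ (Submodule.subset_span ⟨v * Fin.revPerm, ?_⟩)
  have hrev : (Fin.revPerm : Equiv.Perm (Fin n)) * Fin.revPerm = 1 := by
    ext i
    simp
  rw [qSchubert, qDouble, mul_assoc, hrev, mul_one, constantCoeff_eq]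
  simp [← constantCoeff_eq, eval_zero']

theorem prod_range_qe_mem_span_qSchubert (p : ℕ → ℕ) (hp : ∀ j, p j ≤ j) :
    ∏ j ∈ Finset.range n, qe (xVar n) (qVar n) j (p j) ∈
      Submodule.span ℤ (Set.range (qSchubert (n := n))) := by
  have e : ∏ j ∈ Finset.range n, qe (xVar n) (qVar n) j (p j) =
      ∏ i : Fin (n - 1), qe (xVar n) (qVar n) (i.1 + 1) (p (i.1 + 1)) := by
    rw [Fin.prod_univ_eq_prod_range (fun i => qe (xVar n) (qVar n) (i + 1) (p (i + 1))) (n - 1)]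
    rcases n with _ | n
    · simp
    -- The additional factor j = 0 is e_0 = 1, because p_0 ≤ 0.
    · rw [Finset.prod_range_succ', Nat.le_zero.1 (hp 0), qe_zero_right, mul_one]
      rfl
  rw [e]
  exact prod_qe_mem_span_qSchubert _ fun i => hp _

/-- The quantum Schubert polynomials span modulo the quantum elementary polynomials. -/
theorem exists_sub_sum_qSchubert_mem (f : XQ n) :
    ∃ c : Equiv.Perm (Fin n) → MvPolynomial (Fin (n - 1)) ℤ,
      f - ∑ τ, rename Sum.inr (c τ) * qSchubert τ ∈ qIdeal n := by
  obtain ⟨g, hg, h, hh, hgh⟩ := Submodule.mem_sup.1 (mem_span_sup_elemIdeal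
    (u := fun p : {p : ℕ → ℕ // ∀ j, p j ≤ j} => ∏ j ∈ Finset.range n,
      qe (xs n _) (fun j => C (qCoeff n j)) j (p.1 j)) (span_qe_products (qCoeff n)) (xqEquiv n f))
  have hle : Submodule.span (MvPolynomial (Fin (n - 1)) ℤ)
      (Set.range fun p : {p : ℕ → ℕ // ∀ j, p j ≤ j} => ∏ j ∈ Finset.range n,
        qe (xs n _) (fun j => C (qCoeff n j)) j (p.1 j)) ≤
      Submodule.span (MvPolynomial (Fin (n - 1)) ℤ)
        (Set.range fun τ : Equiv.Perm (Fin n) => xqEquiv n (qSchubert τ)) := by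
    rw [Submodule.span_le]
    rintro _ ⟨p, rfl⟩
    obtain ⟨c, hc⟩ := (Submodule.mem_span_range_iff_exists_fun ℤ).1
      (prod_range_qe_mem_span_qSchubert (n := n) p.1 p.2)
    have h1 := congrArg (xqEquiv n) hc
    rw [map_prod, map_sum] at h1
    have h2 : ∀ j, xqEquiv n (qe (xVar n) (qVar n) j (p.1 j)) =
        qe (xs n _) (fun j => C (qCoeff n j)) j (p.1 j) := by
      intro j
      have := map_qe (RingHomClass.toRingHom (xqEquiv n)) (xVar n) (qVar n) j (p.1 j)
      refine this.trans ?_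
      congr 1
      · exact funext xqEquiv_xVar
      · exact funext xqEquiv_qVar
    simp only [h2] at h1
    simp only [SetLike.mem_coe, ← h1]
    refine sum_mem fun τ _ => ?_
    rw [map_zsmul]
    refine zsmul_mem ?_ _
    exact Submodule.subset_span (Set.mem_range_self τ)
  obtain ⟨c, hc⟩ := (Submodule.mem_span_range_iff_exists_fun
    (MvPolynomial (Fin (n - 1)) ℤ)).1 (hle hg)
  refine ⟨c, ?_⟩
  rw [mem_qIdeal_iff, map_sub, ← hgh, ← hc, map_sum]
  have : ∀ τ, xqEquiv n (rename Sum.inr (c τ) * qSchubert τ) = c τ • xqEquiv n (qSchubert τ) :=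
    fun τ => by rw [map_mul, xqEquiv_rename_inr, smul_eq_C_mul]
  simp only [this]
  rw [add_sub_cancel_left]
  exact hh

theorem card_stair : Fintype.card (Stair n) = Fintype.card (Equiv.Perm (Fin n)) := by
  classical
  rw [Fintype.card_coe, Finsupp.card_Iic, Fintype.card_perm, Fintype.card_fin]
  have h1 : ∏ i ∈ (stair n).support, (Finset.Iic (stair n i)).card =
      ∏ i : Fin n, (n - 1 - i.1 + 1) := by
    refine (Finset.prod_congr rfl fun i _ => ?_).trans
      (Finset.prod_subset (Finset.subset_univ _) fun i _ hi => ?_)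
    · rw [Nat.card_Iic, stair_apply]
    · rw [Finsupp.notMem_support_iff, stair_apply] at hi
      rw [hi, zero_add]
  rw [h1, Fin.prod_univ_eq_prod_range (fun i => n - 1 - i + 1) n,
    Finset.prod_range_reflect (fun i => i + 1) n, Finset.prod_range_add_one_eq_factorial]

/-- The quantum Schubert polynomials are linearly independent modulo the quantum elementary
polynomials. -/
theorem eq_zero_of_sum_qSchubert_mem {c : Equiv.Perm (Fin n) → MvPolynomial (Fin (n - 1)) ℤ}
    (hc : ∑ τ, rename Sum.inr (c τ) * qSchubert τ ∈ qIdeal n) : c = 0 := by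
  classical
  set I := elemIdeal n (qCoeff n)
  let S : Equiv.Perm (Fin n) → MvPolynomial (Fin n) (MvPolynomial (Fin (n - 1)) ℤ) :=
    fun τ => xqEquiv n (qSchubert τ)
  have hS : ∀ c : Equiv.Perm (Fin n) → MvPolynomial (Fin (n - 1)) ℤ,
      xqEquiv n (∑ τ, rename Sum.inr (c τ) * qSchubert τ) = ∑ τ, c τ • S τ := by
    intro c
    rw [map_sum]
    exact Finset.sum_congr rfl fun τ _ => by rw [map_mul, xqEquiv_rename_inr, smul_eq_C_mul]
  -- G expresses the S_τ in staircase monomials and H the staircase monomials in the S_τ, both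
  -- modulo the ideal. Independence of the staircase monomials gives HG = 1. Both index sets have n!
  -- elements, so GH = 1 as well, and a relation c satisfies cG = 0, hence c = 0.
  choose G hG using fun τ => exists_stair_sub_mem (qCoeff n) (S τ)
  choose H hH using fun a : Stair n =>
    exists_sub_sum_qSchubert_mem ((xqEquiv n).symm (monomial a.1 1))
  have hH' : ∀ a : Stair n, monomial a.1 1 - ∑ τ, H a τ • S τ ∈ I := by
    intro a
    have := (mem_qIdeal_iff _).1 (hH a)
    rwa [map_sub, AlgEquiv.apply_symm_apply, hS] at this
  have hcomb : ∀ d : Equiv.Perm (Fin n) → MvPolynomial (Fin (n - 1)) ℤ,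
      ∑ τ, d τ • S τ - ∑ a : Stair n, (∑ τ, d τ * G τ a) • monomial a.1 1 ∈ I := by
    intro d
    have e : ∑ τ, d τ • S τ - ∑ a : Stair n, (∑ τ, d τ * G τ a) • monomial a.1 1 =
        ∑ τ, d τ • (S τ - ∑ a, G τ a • monomial a.1 1) := by
      simp only [smul_sub, Finset.sum_sub_distrib, Finset.sum_smul, Finset.smul_sum, smul_smul]
      rw [Finset.sum_comm]
    rw [e]
    refine sum_mem fun τ _ => ?_
    rw [smul_eq_C_mul]
    exact Ideal.mul_mem_left _ _ (hG τ)
  have hHG : Matrix.of H * Matrix.of G = 1 := by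
    ext1 a b
    have h1 := add_mem (hH' a) (hcomb (H a))
    rw [sub_add_sub_cancel] at h1
    have h2 : ∑ b : Stair n, ((if b = a then 1 else 0) - ∑ τ, H a τ * G τ b) •
        (monomial b.1 1 : MvPolynomial (Fin n) (MvPolynomial (Fin (n - 1)) ℤ)) ∈ I := by
      simp only [sub_smul, Finset.sum_sub_distrib, ite_smul, one_smul, zero_smul]
      rw [Finset.sum_ite_eq' Finset.univ a, if_pos (Finset.mem_univ a)]
      exact h1
    have h3 := congrFun (stair_eq_zero_of_mem (qCoeff n) h2) b
    rw [Pi.zero_apply, sub_eq_zero] at h3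
    rw [Matrix.mul_apply, Matrix.one_apply]
    simp only [Matrix.of_apply, ← h3, eq_comm (a := a)]
  have hGH : Matrix.of G * Matrix.of H = 1 :=
    (Matrix.mul_eq_one_comm_of_card_eq _ _ _ card_stair).1 hHG
  have h1 : ∑ τ, c τ • S τ ∈ I := by
    rw [← hS]
    exact (mem_qIdeal_iff _).1 hc
  have h2 := stair_eq_zero_of_mem (qCoeff n)
    (by simpa using sub_mem h1 (hcomb c) :
      ∑ a : Stair n, (∑ τ, c τ * G τ a) • monomial a.1 1 ∈ I)
  have h3 : Matrix.vecMul c (Matrix.of G) = 0 := h2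
  have h4 := congrArg (fun z => Matrix.vecMul z (Matrix.of H)) h3
  simpa only [Matrix.vecMul_vecMul, hGH, Matrix.vecMul_one, Matrix.zero_vecMul] using h4

theorem existsUnique_isStructConst (u w : Equiv.Perm (Fin n)) :
    ∃! c : Equiv.Perm (Fin n) → MvPolynomial (Fin (n - 1)) ℤ, IsStructConst u w c := by
  obtain ⟨c, hc⟩ := exists_sub_sum_qSchubert_mem (qSchubert u * qSchubert w)
  refine ⟨c, hc, fun c' hc' => ?_⟩
  rw [← sub_eq_zero]
  refine eq_zero_of_sum_qSchubert_mem ?_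
  have h := sub_mem hc hc'
  rw [sub_sub_sub_cancel_left, ← Finset.sum_sub_distrib] at h
  simpa only [Pi.sub_apply, map_sub, sub_mul] using h

theorem isStructConst_structConst (u w : Equiv.Perm (Fin n)) :
    IsStructConst u w (structConst u w) :=
  Classical.epsilon_spec (existsUnique_isStructConst u w).exists

end SchubertSpan

/-! ### Reduction modulo the ideal in ℚ[x, q, t] -/

section RationalPolynomials

variable {n : ℕ}

/-- The polynomial ring `ℚ[q, t]`. -/
abbrev QT (n : ℕ) : Type := MvPolynomial (Fin (n - 1) ⊕ Equiv.Perm (Fin n)) ℚ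

/-- `ℚ[x, q, t]` as the polynomial ring in `x` over `ℚ[q, t]`. -/
noncomputable def xqtEquiv (n : ℕ) :
    MvPolynomial (Vars n) ℚ ≃ₐ[ℚ] MvPolynomial (Fin n) (QT n) :=
  (renameEquiv ℚ (Equiv.sumAssoc (Fin n) (Fin (n - 1)) (Equiv.Perm (Fin n)))).trans
    (sumAlgEquiv ℚ (Fin n) (Fin (n - 1) ⊕ Equiv.Perm (Fin n)))

theorem xqtEquiv_C (r : ℚ) : xqtEquiv n (C r) = C (C r) := by
  simp [xqtEquiv]

theorem xqtEquiv_X_x (j : Fin n) : xqtEquiv n (X (Sum.inl (Sum.inl j))) = X j := by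
  simp [xqtEquiv]

theorem xqtEquiv_X_q (i : Fin (n - 1)) :
    xqtEquiv n (X (Sum.inl (Sum.inr i))) = C (X (Sum.inl i)) := by
  simp [xqtEquiv]

theorem xqtEquiv_X_t (w : Equiv.Perm (Fin n)) :
    xqtEquiv n (X (Sum.inr w)) = C (X (Sum.inr w)) := by
  simp [xqtEquiv]

/-- The exponent in `x, q, t` with given parts in `x` and in `q, t`. -/
noncomputable def joinExponent (a : Fin n →₀ ℕ) (b : Fin (n - 1) ⊕ Equiv.Perm (Fin n) →₀ ℕ) :
    Vars n →₀ ℕ :=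
  Finsupp.equivFunOnFinite.symm (Sum.elim (Sum.elim a (b ∘ Sum.inl)) (b ∘ Sum.inr))

theorem exists_joinExponent (m : Vars n →₀ ℕ) : ∃ b, m = joinExponent
    (Finsupp.equivFunOnFinite.symm fun j => m (Sum.inl (Sum.inl j))) b := by
  refine ⟨Finsupp.equivFunOnFinite.symm
    (Sum.elim (fun i => m (Sum.inl (Sum.inr i))) fun w => m (Sum.inr w)), ?_⟩
  ext ((j | i) | w) <;> rfl

theorem xqtEquiv_monomial (a : Fin n →₀ ℕ) (b : Fin (n - 1) ⊕ Equiv.Perm (Fin n) →₀ ℕ) (r : ℚ) :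
    xqtEquiv n (monomial (joinExponent a b) r) = monomial a (monomial b r) := by
  rw [monomial_eq, monomial_eq (s := a), monomial_eq (s := b),
    Finsupp.prod_fintype _ _ fun i => pow_zero _, Finsupp.prod_fintype _ _ fun i => pow_zero _,
    Finsupp.prod_fintype _ _ fun i => pow_zero _, Fintype.prod_sum_type, Fintype.prod_sum_type,
    Fintype.prod_sum_type]
  simp only [map_mul, map_prod, map_pow, xqtEquiv_C, xqtEquiv_X_x, xqtEquiv_X_q, xqtEquiv_X_t]
  have h1 : ∀ j, joinExponent a b (Sum.inl (Sum.inl j)) = a j := fun _ => rfl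
  have h2 : ∀ j, joinExponent a b (Sum.inl (Sum.inr j)) = b (Sum.inl j) := fun _ => rfl
  have h3 : ∀ j, joinExponent a b (Sum.inr j) = b (Sum.inr j) := fun _ => rfl
  simp only [h1, h2, h3]
  ring

/-- The variables `q_0, …, q_{n-2}` of `ℚ[q, t]`, continued by zero. -/
noncomputable def qtCoeff (n : ℕ) (j : ℕ) : QT n :=
  if h : j < n - 1 then X (Sum.inl ⟨j, h⟩) else 0

/-- The inclusion of `ℤ[x, q]` into `ℚ[x, q, t]`. -/
noncomputable def polyOfXQ (n : ℕ) : XQ n →ₐ[ℤ] MvPolynomial (Vars n) ℚ :=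
  aeval fun s => X (Sum.inl s)

theorem coe_polyOfXQ (p : XQ n) : (polyOfXQ n p : PS n) = ofXQ n p := by
  have : ((coeToMvPowerSeries.ringHom (σ := Vars n) (R := ℚ)).comp
      (polyOfXQ n : XQ n →+* MvPolynomial (Vars n) ℚ)) = (ofXQ n : XQ n →+* PS n) := by
    refine ringHom_ext (fun r => ?_) fun s => ?_
    · simp
    · simp [polyOfXQ, ofXQ]
  exact DFunLike.congr_fun this p

/-- The ideal of `ℚ[x, q, t]` generated by the quantum elementary polynomials. -/
noncomputable def qIdealPoly (n : ℕ) : Ideal (MvPolynomial (Vars n) ℚ) :=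
  Ideal.span (Set.range fun i : Fin n => polyOfXQ n (qElem n n (i.1 + 1)))

theorem mem_qIdealPoly_iff (f : MvPolynomial (Vars n) ℚ) :
    f ∈ qIdealPoly n ↔ xqtEquiv n f ∈ elemIdeal n (qtCoeff n) := by
  have hx : ∀ j, (xqtEquiv n).toRingEquiv (polyOfXQ n (xVar n j)) = xs n (QT n) j := by
    intro j
    rw [xVar, xs]
    split_ifs
    · rw [polyOfXQ, aeval_X]
      exact xqtEquiv_X_x _
    · rw [map_zero, map_zero]
  have hq : ∀ j, (xqtEquiv n).toRingEquiv (polyOfXQ n (qVar n j)) = C (qtCoeff n j) := by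
    intro j
    rw [qVar, qtCoeff]
    split_ifs
    · rw [polyOfXQ, aeval_X]
      exact xqtEquiv_X_q _
    · rw [map_zero, map_zero, map_zero]
  have h := mem_elemIdeal_iff (xqtEquiv n).toRingEquiv hx hq f
  refine Iff.trans ?_ h
  rw [qIdealPoly]
  suffices e : (Set.range fun i : Fin n => polyOfXQ n (qElem n n (i.1 + 1))) =
      {e | ∃ i : ℕ, 1 ≤ i ∧ i ≤ n ∧ e = qe (fun j => polyOfXQ n (xVar n j))
        (fun j => polyOfXQ n (qVar n j)) n i} by rw [e]
  have hqe : ∀ i ≤ n, polyOfXQ n (qElem n n i) = qe (fun j => polyOfXQ n (xVar n j))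
      (fun j => polyOfXQ n (qVar n j)) n i := by
    intro i hi
    rw [qElem_eq_qe n hi]
    exact map_qe (polyOfXQ n : XQ n →+* MvPolynomial (Vars n) ℚ) _ _ _ _
  ext z
  constructor
  · rintro ⟨i, rfl⟩
    exact ⟨i.1 + 1, by omega, i.2, hqe _ i.2⟩
  · rintro ⟨i, h1, h2, rfl⟩
    refine ⟨⟨i - 1, by omega⟩, ?_⟩
    simp only [Nat.sub_add_cancel h1]
    exact hqe i h2

theorem exists_inStaircase_sub_mem (f : MvPolynomial (Vars n) ℚ) :
    ∃ g : MvPolynomial (Vars n) ℚ, InStaircase (g : PS n) ∧ f - g ∈ qIdealPoly n := by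
  obtain ⟨c, hc⟩ := exists_stair_sub_mem (qtCoeff n) (xqtEquiv n f)
  refine ⟨(xqtEquiv n).symm (∑ a, c a • monomial a.1 1), ?_, ?_⟩
  · have e : (xqtEquiv n).symm (∑ a, c a • monomial a.1 1) =
        ∑ a : Stair n, ∑ b ∈ (c a).support, monomial (joinExponent a.1 b) (coeff b (c a)) := by
      rw [AlgEquiv.symm_apply_eq, map_sum]
      refine Finset.sum_congr rfl fun a _ => ?_
      rw [map_sum]
      simp only [xqtEquiv_monomial]
      rw [← map_sum, support_sum_monomial_coeff, smul_monomial, smul_eq_mul, mul_one]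
    intro m hm j
    rw [coeff_coe, e, coeff_sum] at hm
    obtain ⟨a, -, ha⟩ := Finset.exists_ne_zero_of_sum_ne_zero hm
    rw [coeff_sum] at ha
    obtain ⟨b, -, hb⟩ := Finset.exists_ne_zero_of_sum_ne_zero ha
    rw [coeff_monomial] at hb
    have hmj : joinExponent a.1 b = m := by
      by_contra h
      exact hb (if_neg h)
    rw [← hmj]
    exact Finset.mem_Iic.1 a.2 j
  · rw [mem_qIdealPoly_iff, map_sub, AlgEquiv.apply_symm_apply]
    exact hc

theorem eq_zero_of_inStaircase_of_mem {g : MvPolynomial (Vars n) ℚ} (hg : InStaircase (g : PS n))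
    (hmem : g ∈ qIdealPoly n) : g = 0 := by
  have h1 : xqtEquiv n g ∈ Submodule.span (QT n)
      (Set.range fun a : Stair n => (monomial a.1 1 : MvPolynomial (Fin n) (QT n))) := by
    rw [← support_sum_monomial_coeff g, map_sum]
    refine sum_mem fun m hm => ?_
    obtain ⟨b, hb⟩ := exists_joinExponent m
    set a : Fin n →₀ ℕ := Finsupp.equivFunOnFinite.symm fun j => m (Sum.inl (Sum.inl j)) with ha
    have hastair : a ≤ stair n := fun j =>
      hg m (by rw [coeff_coe]; exact mem_support_iff.1 hm) j
    rw [hb, xqtEquiv_monomial]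
    have e : (monomial a (monomial b (coeff (joinExponent a b) g)) : MvPolynomial (Fin n) (QT n)) =
        (monomial b (coeff (joinExponent a b) g) : QT n) • monomial a 1 := by
      rw [smul_monomial, smul_eq_mul, mul_one]
    rw [e]
    exact Submodule.smul_mem _ _ (Submodule.subset_span ⟨⟨a, Finset.mem_Iic.2 hastair⟩, rfl⟩)
  obtain ⟨c, hc⟩ := (Submodule.mem_span_range_iff_exists_fun (QT n)).1 h1
  have h2 := stair_eq_zero_of_mem (qtCoeff n) (c := c)
    (by rw [hc]; exact (mem_qIdealPoly_iff g).1 hmem)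
  apply (xqtEquiv n).injective
  rw [← hc, h2, map_zero]
  simp

end RationalPolynomials

/-! ### From polynomials to power series, degree by degree -/

section Weights

variable {n : ℕ}

theorem isWeightedHomogeneous_qe {σ R : Type*} [CommRing R] {w : σ → ℕ}
    {v q : ℕ → MvPolynomial σ R} (hv : ∀ j, IsWeightedHomogeneous w (v j) 1)
    (hq : ∀ j, IsWeightedHomogeneous w (q j) 2) (k i : ℕ) :
    IsWeightedHomogeneous w (qe v q k i) i := by
  induction k using Nat.strong_induction_on generalizing i with
  | _ k ih =>
    match k, i with
    | k, 0 => rw [qe_zero_right]; exact isWeightedHomogeneous_one _ _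
    | 0, i + 1 =>
      rw [qe_of_lt _ _ (Nat.succ_pos i)]; exact isWeightedHomogeneous_zero _ _ _
    | 1, 1 => rw [qe]; exact hv 0
    | 1, i + 2 => rw [qe]; exact isWeightedHomogeneous_zero _ _ _
    | k + 2, 1 => rw [qe]; exact (ih (k + 1) (by omega) 1).add (hv _)
    | k + 2, i + 2 =>
      have h2 := (hv (k + 1)).mul (ih (k + 1) (by omega) (i + 1))
      have h3 := (hq k).mul (ih k (by omega) i)
      rw [show 1 + (i + 1) = i + 2 by omega] at h2
      rw [add_comm] at h3
      rw [qe]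
      exact ((ih (k + 1) (by omega) (i + 2)).add h2).add h3

/-- The grading with `x` and `t` in degree one and `q` in degree two. -/
def grading (n : ℕ) : Vars n → ℕ := Sum.elim (Sum.elim (fun _ => 1) fun _ => 2) fun _ => 1

theorem isWeightedHomogeneous_qElem {i : ℕ} (hi : i ≤ n) :
    IsWeightedHomogeneous (grading n) (polyOfXQ n (qElem n n i)) i := by
  rw [qElem_eq_qe n hi]
  have := map_qe (polyOfXQ n : XQ n →+* MvPolynomial (Vars n) ℚ) (xVar n) (qVar n) n i
  rw [RingHom.coe_coe] at this
  rw [this]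
  refine isWeightedHomogeneous_qe (fun j => ?_) (fun j => ?_) n i
  · rw [Function.comp_apply, xVar]
    split_ifs
    · rw [polyOfXQ, aeval_X]
      exact isWeightedHomogeneous_X _ _ _
    · rw [map_zero]; exact isWeightedHomogeneous_zero _ _ _
  · rw [Function.comp_apply, qVar]
    split_ifs
    · rw [polyOfXQ, aeval_X]
      exact isWeightedHomogeneous_X _ _ _
    · rw [map_zero]; exact isWeightedHomogeneous_zero _ _ _

theorem finite_grading (n k d : ℕ) :
    {m : Vars n →₀ ℕ | Finsupp.weight (grading n) m + k = d}.Finite := by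
  refine (Finsupp.finite_of_nat_weight_le (grading n) ?_ d).subset fun m hm => ?_
  · rintro ((_ | _) | _) <;> simp [grading]
  · exact le_of_add_le_left (le_of_eq hm)

/-- The part of a power series in degree `d - k`, with `0` for `d < k`. -/
noncomputable def slice (k d : ℕ) (f : PS n) : MvPolynomial (Vars n) ℚ :=
  ∑ m ∈ (finite_grading n k d).toFinset, monomial m (MvPowerSeries.coeff m f)

theorem coeff_slice (k d : ℕ) (f : PS n) (m : Vars n →₀ ℕ) : coeff m (slice k d f) =
    if Finsupp.weight (grading n) m + k = d then MvPowerSeries.coeff m f else 0 := by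
  classical
  rw [slice, coeff_sum]
  simp only [coeff_monomial]
  rw [Finset.sum_ite_eq' _ m]
  simp only [Set.Finite.mem_toFinset, Set.mem_ofPred_eq]

/-- A factor homogeneous of degree k relates a coefficient of the product only to coefficients lying
exactly k degrees lower. -/
theorem coeff_mul_congr {p : MvPolynomial (Vars n) ℚ} {k : ℕ}
    (hp : IsWeightedHomogeneous (grading n) p k) {f g : PS n} {m : Vars n →₀ ℕ}
    (h : ∀ a, Finsupp.weight (grading n) a + k = Finsupp.weight (grading n) m →
      MvPowerSeries.coeff a f = MvPowerSeries.coeff a g) :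
    MvPowerSeries.coeff m (f * (p : PS n)) = MvPowerSeries.coeff m (g * (p : PS n)) := by
  classical
  rw [MvPowerSeries.coeff_mul, MvPowerSeries.coeff_mul]
  refine Finset.sum_congr rfl fun x hx => ?_
  rw [Finset.HasAntidiagonal.mem_antidiagonal] at hx
  rw [coeff_coe]
  by_cases hk : Finsupp.weight (grading n) x.2 = k
  · rw [h x.1]
    rw [← hx, map_add, hk]
  · rw [hp.coeff_eq_zero _ hk, mul_zero, mul_zero]

theorem mem_qIdealPS_iff (f : PS n) : f ∈ qIdealPS n ↔ ∃ h : Fin n → PS n,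
    ∑ i, h i * (polyOfXQ n (qElem n n (i.1 + 1)) : PS n) = f := by
  have e : (ofXQ n : XQ n →+* PS n) '' {e | ∃ i : ℕ, 1 ≤ i ∧ i ≤ n ∧ e = qElem n n i} =
      Set.range fun i : Fin n => (polyOfXQ n (qElem n n (i.1 + 1)) : PS n) := by
    ext z
    constructor
    · rintro ⟨_, ⟨i, h1, h2, rfl⟩, rfl⟩
      refine ⟨⟨i - 1, by omega⟩, ?_⟩
      simp only [Nat.sub_add_cancel h1, coe_polyOfXQ]
      rfl
    · rintro ⟨i, rfl⟩
      exact ⟨_, ⟨i.1 + 1, by omega, i.2, rfl⟩, (coe_polyOfXQ _).symm⟩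
  have e' : qIdealPS n =
      Ideal.span (Set.range fun i : Fin n => (polyOfXQ n (qElem n n (i.1 + 1)) : PS n)) := by
    rw [← e, qIdealPS, qIdeal, ← Ideal.map_span]
    rfl
  rw [e']
  exact Submodule.mem_span_range_iff_exists_fun (PS n)

/-- Each homogeneous slice of f is reduced as a polynomial. From the d-th solution only the part of
g in degree d is kept, and these parts are glued. -/
theorem exists_isProj (f : PS n) : ∃ g, IsProj f g := by
  choose G hG hmem using fun d => exists_inStaircase_sub_mem (slice 0 d f)
  choose H hH using fun d => (Submodule.mem_span_range_iff_exists_fun _).1 (hmem d)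
  let wt : (Vars n →₀ ℕ) → ℕ := fun m => Finsupp.weight (grading n) m
  let g : PS n := fun m => coeff m (G (wt m))
  -- The generator paired with index i has degree i + 1, so the coefficient of h_i at m enters the
  -- equation in degree wt m + (i + 1) and is taken from the solution in that degree.
  let h : Fin n → PS n := fun i m => coeff m (H (wt m + (i.1 + 1)) i)
  have hg : ∀ m, MvPowerSeries.coeff m g = coeff m (G (wt m)) := fun _ => rfl
  have hh : ∀ i m, MvPowerSeries.coeff m (h i) = coeff m (H (wt m + (i.1 + 1)) i) :=
    fun _ _ => rfl
  refine ⟨g, fun m hm => ?_, ?_⟩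
  · refine hG (wt m) m ?_
    rw [coeff_coe]
    exact hm
  · rw [mem_qIdealPS_iff]
    refine ⟨h, ?_⟩
    ext m
    have h1 : ∀ i, MvPowerSeries.coeff m (h i * (polyOfXQ n (qElem n n (i.1 + 1)) : PS n)) =
        coeff m (H (wt m) i * polyOfXQ n (qElem n n (i.1 + 1))) := by
      intro i
      rw [← coeff_coe, coe_mul]
      refine coeff_mul_congr (isWeightedHomogeneous_qElem i.2) fun a ha => ?_
      rw [hh, coeff_coe]
      simp only [wt, ha]
    have h2 := congrArg (coeff m) (hH (wt m))
    rw [coeff_sum, coeff_sub, coeff_slice, if_pos (add_zero _)] at h2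
    rw [map_sum, map_sub, hg, ← h2]
    exact Finset.sum_congr rfl fun i _ => h1 i

/-- As the generators are homogeneous, each slice of g lies in the polynomial ideal, with the slices
of the h_i, lowered by i + 1, as coefficients. It is still on the staircase, hence zero. -/
theorem eq_zero_of_inStaircase {g : PS n} (hg : InStaircase g) (hmem : g ∈ qIdealPS n) :
    g = 0 := by
  obtain ⟨h, hh⟩ := (mem_qIdealPS_iff g).1 hmem
  have key : ∀ d, slice 0 d g = 0 := by
    intro d
    refine eq_zero_of_inStaircase_of_mem (fun m hm => ?_) ?_
    · rw [coeff_coe, coeff_slice] at hm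
      exact hg m fun h0 => hm (by rw [h0, ite_self])
    · refine (Submodule.mem_span_range_iff_exists_fun _).2 ⟨fun i => slice (i.1 + 1) d (h i), ?_⟩
      ext m
      rw [coeff_sum, coeff_slice, add_zero, ← hh, map_sum]
      by_cases hd : Finsupp.weight (grading n) m = d
      · rw [if_pos hd]
        refine Finset.sum_congr rfl fun i _ => ?_
        rw [smul_eq_mul, ← coeff_coe, coe_mul]
        refine coeff_mul_congr (isWeightedHomogeneous_qElem i.2) fun a ha => ?_
        rw [coeff_coe, coeff_slice, if_pos (ha.trans hd)]
      · rw [if_neg hd]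
        refine Finset.sum_eq_zero fun i _ => ?_
        rw [smul_eq_mul, ← coeff_coe, coe_mul, coeff_mul_congr (g := 0)
          (isWeightedHomogeneous_qElem i.2) fun a ha => ?_, zero_mul, map_zero]
        rw [coeff_coe, coeff_slice, if_neg, map_zero]
        exact fun h0 => hd (ha.symm.trans h0)
  ext m
  have := congrArg (coeff m) (key (Finsupp.weight (grading n) m))
  rwa [coeff_slice, if_pos (add_zero _), coeff_zero] at this

theorem existsUnique_isProj (f : PS n) : ∃! g, IsProj f g := by
  obtain ⟨g, hg⟩ := exists_isProj f
  refine ⟨g, hg, fun g' hg' => ?_⟩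
  rw [← sub_eq_zero]
  refine eq_zero_of_inStaircase (fun m hm => ?_) ?_
  · rw [map_sub] at hm
    by_cases h : MvPowerSeries.coeff m g = 0
    · rw [h, sub_zero] at hm
      exact hg'.1 m hm
    · exact hg.1 m h
  · have := sub_mem hg.2 hg'.2
    rwa [sub_sub_sub_cancel_left] at this

end Weights

/-! ### The derivative of an exponential power series -/

section ChainRule

variable {σ : Type*}

/-- The power a^d has order at least d, so only exponents d up to the degree of e contribute. -/
theorem coeff_subst_eq_sum {a : MvPowerSeries σ ℚ} (ha : MvPowerSeries.constantCoeff a = 0)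
    (f : PowerSeries ℚ) {e : σ →₀ ℕ} {N : ℕ} (hN : e.degree < N) :
    MvPowerSeries.coeff e (f.subst a) =
      MvPowerSeries.coeff e (∑ d ∈ Finset.range N, PowerSeries.coeff d f • a ^ d) := by
  rw [PowerSeries.coeff_subst (PowerSeries.HasSubst.of_constantCoeff_zero ha), map_sum,
    finsum_eq_sum_of_support_subset]
  · rfl
  · intro d hd
    rw [Function.mem_support] at hd
    rw [Finset.coe_range, Set.mem_Iio]
    by_contra h
    refine hd ?_
    rw [MvPowerSeries.coeff_eq_zero_of_constantCoeff_nilpotent (m := 1) (by rw [ha, pow_one])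
      (by omega), smul_zero]

/-- The chain rule for the exponential of a power series. -/
theorem pderiv_exp_subst (s : σ) {a : MvPowerSeries σ ℚ} (ha : MvPowerSeries.constantCoeff a = 0) :
    MvPowerSeries.pderiv ℚ s ((PowerSeries.exp ℚ).subst a) =
      MvPowerSeries.pderiv ℚ s a * (PowerSeries.exp ℚ).subst a := by
  classical
  ext e
  -- The identity holds for truncated exponentials. The left one has a term more, since the
  -- derivative at e reads a coefficient of degree one higher.
  have h1 : MvPowerSeries.pderiv ℚ s
      (∑ d ∈ Finset.range (e.degree + 1 + 1), PowerSeries.coeff d (PowerSeries.exp ℚ) • a ^ d) =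
      MvPowerSeries.pderiv ℚ s a *
        ∑ d ∈ Finset.range (e.degree + 1), PowerSeries.coeff d (PowerSeries.exp ℚ) • a ^ d := by
    rw [map_sum, Finset.sum_range_succ', pow_zero, Derivation.map_smul, Derivation.map_one_eq_zero,
      smul_zero, add_zero, Finset.mul_sum]
    refine Finset.sum_congr rfl fun d _ => ?_
    rw [Derivation.map_smul, Derivation.leibniz_pow, Nat.add_sub_cancel, mul_smul_comm,
      smul_eq_mul, ← Nat.cast_smul_eq_nsmul ℚ, smul_smul, mul_comm (a ^ d)]
    congr 1
    rw [PowerSeries.coeff_exp, PowerSeries.coeff_exp, Nat.factorial_succ]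
    simp only [Algebra.algebraMap_self, RingHom.id_apply]
    push_cast
    have : (d : ℚ) + 1 ≠ 0 := by positivity
    have : (d.factorial : ℚ) ≠ 0 := by positivity
    field_simp
  rw [MvPowerSeries.coeff_pderiv, coeff_subst_eq_sum ha _ (N := e.degree + 1 + 1)
    (by rw [map_add, Finsupp.degree_single]; omega), ← MvPowerSeries.coeff_pderiv, h1,
    MvPowerSeries.coeff_mul, MvPowerSeries.coeff_mul]
  refine Finset.sum_congr rfl fun p hp => ?_
  rw [Finset.HasAntidiagonal.mem_antidiagonal] at hp
  rw [coeff_subst_eq_sum ha _ (N := e.degree + 1)]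
  rw [← hp, map_add]
  omega

end ChainRule

/-! ### The projection, differentiation in t, and the deformed polynomials -/

section Deformation

variable {n : ℕ}

theorem isProj_proj (f : PS n) : IsProj f (proj f) :=
  Classical.epsilon_spec (exists_isProj f)

theorem proj_eq {f g : PS n} (h : IsProj f g) : proj f = g :=
  (existsUnique_isProj f).unique (isProj_proj f) h

theorem proj_congr {f g : PS n} (h : f - g ∈ qIdealPS n) : proj f = proj g := by
  refine proj_eq ⟨(isProj_proj g).1, ?_⟩
  have := add_mem h (isProj_proj g).2
  rwa [sub_add_sub_cancel] at this

theorem InStaircase.add {f g : PS n} (hf : InStaircase f) (hg : InStaircase g) :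
    InStaircase (f + g) := by
  intro m hm
  rw [map_add] at hm
  by_cases h : MvPowerSeries.coeff m f = 0
  · rw [h, zero_add] at hm
    exact hg m hm
  · exact hf m h

theorem InStaircase.zero : InStaircase (0 : PS n) := fun _ hm => absurd (map_zero _) hm

theorem InStaircase.sum {ι : Type*} (s : Finset ι) {f : ι → PS n}
    (h : ∀ i ∈ s, InStaircase (f i)) : InStaircase (∑ i ∈ s, f i) :=
  Finset.sum_induction _ _ (fun _ _ => InStaircase.add) InStaircase.zero h

theorem InStaircase.X_mul (i : Fin (n - 1)) {f : PS n} (hf : InStaircase f) :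
    InStaircase (MvPowerSeries.X (Sum.inl (Sum.inr i)) * f) := by
  classical
  intro m hm j
  rw [MvPowerSeries.coeff_mul] at hm
  obtain ⟨p, hp, hne⟩ := Finset.exists_ne_zero_of_sum_ne_zero hm
  rw [Finset.HasAntidiagonal.mem_antidiagonal] at hp
  have h1 := left_ne_zero_of_mul hne
  rw [MvPowerSeries.coeff_X] at h1
  have h2 : p.1 = Finsupp.single (Sum.inl (Sum.inr i)) 1 := by
    by_contra h
    exact h1 (if_neg h)
  have h3 := hf _ (right_ne_zero_of_mul hne) j
  rw [← hp, h2, Finsupp.add_apply, Finsupp.single_eq_of_ne (by simp), zero_add]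
  exact h3

theorem InStaircase.ofQ_mul (c : MvPolynomial (Fin (n - 1)) ℤ) {f : PS n} (hf : InStaircase f) :
    InStaircase (ofQ n c * f) := by
  induction c using MvPolynomial.induction_on generalizing f with
  | C a =>
    intro m hm
    refine hf m fun h => hm ?_
    have : ofQ n (C a) = (a : PS n) := by
      rw [ofQ, aeval_C]; simp
    rw [this, ← zsmul_eq_mul, map_zsmul, h, smul_zero]
  | add p q hp hq => rw [map_add, add_mul]; exact (hp hf).add (hq hf)
  | mul_X p i hp =>
    rw [map_mul, mul_assoc]
    refine hp ?_
    rw [ofQ, aeval_X]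
    exact hf.X_mul i

/-- The staircase condition does not concern q, so it survives multiplication by ℤ[q]. -/
theorem proj_sum_ofQ_mul {ι : Type*} (s : Finset ι) (c : ι → MvPolynomial (Fin (n - 1)) ℤ)
    (f : ι → PS n) : proj (∑ i ∈ s, ofQ n (c i) * f i) = ∑ i ∈ s, ofQ n (c i) * proj (f i) := by
  refine proj_eq ⟨InStaircase.sum s fun i _ => (isProj_proj (f i)).1.ofQ_mul (c i), ?_⟩
  rw [← Finset.sum_sub_distrib]
  refine sum_mem fun i _ => ?_
  rw [← mul_sub]
  exact Ideal.mul_mem_left _ _ (isProj_proj (f i)).2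

theorem ofXQ_rename_inr (c : MvPolynomial (Fin (n - 1)) ℤ) :
    ofXQ n (rename Sum.inr c) = ofQ n c := by
  rw [ofXQ, ofQ, aeval_rename]
  rfl

theorem dt_mul (u : Equiv.Perm (Fin n)) (f g : PS n) : dt u (f * g) = f * dt u g + g * dt u f := by
  rw [dt, Derivation.leibniz]; rfl

theorem dt_ofXQ (u : Equiv.Perm (Fin n)) (p : XQ n) : dt u (ofXQ n p) = 0 := by
  induction p using MvPolynomial.induction_on with
  | C a =>
    have : ofXQ n (C a) = (a : PS n) := by
      rw [ofXQ, aeval_C]; simp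
    rw [this, dt, Derivation.map_intCast]
  | add p q hp hq =>
    rw [dt] at hp hq ⊢
    rw [map_add, map_add, hp, hq, add_zero]
  | mul_X p s hp =>
    have : dt u (MvPowerSeries.X (Sum.inl s) : PS n) = 0 :=
      MvPowerSeries.pderiv_X_of_ne Sum.inl_ne_inr
    rw [map_mul, dt_mul, hp, mul_zero, add_zero, ofXQ, aeval_X, this, mul_zero]

theorem dt_mem_qIdealPS (u : Equiv.Perm (Fin n)) {f : PS n} (hf : f ∈ qIdealPS n) :
    dt u f ∈ qIdealPS n := by
  obtain ⟨h, rfl⟩ := (mem_qIdealPS_iff f).1 hf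
  refine (mem_qIdealPS_iff _).2 ⟨fun i => dt u (h i), ?_⟩
  rw [dt, map_sum]
  refine Finset.sum_congr rfl fun i _ => ?_
  change _ = dt u _
  rw [dt_mul, coe_polyOfXQ, dt_ofXQ, mul_zero, zero_add, mul_comm]

theorem InStaircase.dt (u : Equiv.Perm (Fin n)) {f : PS n} (hf : InStaircase f) :
    InStaircase (dt u f) := by
  intro m hm j
  rw [QSchubert.dt, MvPowerSeries.coeff_pderiv] at hm
  have := hf _ (left_ne_zero_of_mul hm) j
  rwa [Finsupp.add_apply, Finsupp.single_eq_of_ne (by simp), add_zero] at this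

/-- Differentiation in t preserves the staircase condition, and also the ideal, whose generators are
free of t. -/
theorem dt_proj (u : Equiv.Perm (Fin n)) (f : PS n) : dt u (proj f) = proj (dt u f) := by
  refine (proj_eq ⟨(isProj_proj f).1.dt u, ?_⟩).symm
  have := dt_mem_qIdealPS u (isProj_proj f).2
  rwa [dt, map_sub] at this

/-- The exponential `exp (∑_w t_w S_w(x))` before projection. -/
noncomputable def expSchubert (n : ℕ) : PS n := (PowerSeries.exp ℚ).subst (exponent n)

theorem dt_exponent (u : Equiv.Perm (Fin n)) : dt u (exponent n) = ofXQ n (qSchubert u) := by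
  rw [exponent, dt, map_sum, Finset.sum_eq_single u]
  · change dt u _ = _
    rw [dt_mul, dt_ofXQ, mul_zero, zero_add, dt, MvPowerSeries.pderiv_X_self, mul_one]
  · intro w _ hw
    change dt u _ = _
    rw [dt_mul, dt_ofXQ, mul_zero, zero_add, dt,
      MvPowerSeries.pderiv_X_of_ne fun h => hw (Sum.inr_injective h), mul_zero]
  · exact fun h => absurd (Finset.mem_univ u) h

theorem dt_expSchubert (u : Equiv.Perm (Fin n)) :
    dt u (expSchubert n) = ofXQ n (qSchubert u) * expSchubert n := by
  rw [← dt_exponent]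
  exact pderiv_exp_subst _ (by simp [exponent])

theorem dt_kernel (w : Equiv.Perm (Fin n)) :
    dt w (kernel n) = proj (expSchubert n * ofXQ n (qSchubert w)) := by
  rw [kernel, dt_proj]
  congr 1
  rw [mul_comm]
  exact dt_expSchubert w

/-- K is congruent to the exponential modulo the ideal, so the inner projection can be dropped. The
right side is also the derivative of K in `dt_kernel`. -/
theorem tSchubert_eq (w : Equiv.Perm (Fin n)) :
    tSchubert w = proj (expSchubert n * ofXQ n (qSchubert w)) := by
  rw [tSchubert]
  refine (proj_congr ?_).symm
  rw [← sub_mul]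
  exact Ideal.mul_mem_right _ _ (isProj_proj _).2

/-- Differentiation brings down the factor S_u, and the congruence for S_u S_w, multiplied by the
exponential, is then projected. -/
theorem dt_tSchubert (u w : Equiv.Perm (Fin n)) :
    dt u (tSchubert w) = ∑ τ, ofQ n (structConst u w τ) * tSchubert τ := by
  simp only [tSchubert_eq]
  rw [dt_proj, ← proj_sum_ofQ_mul]
  refine proj_congr ?_
  have h := Ideal.mem_map_of_mem (ofXQ n) (isStructConst_structConst u w)
  have h' := Ideal.mul_mem_left (qIdealPS n) (expSchubert n) h
  rw [dt_mul, dt_ofXQ, dt_expSchubert]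
  convert h' using 1
  rw [map_sub, map_mul, map_sum, mul_sub, Finset.mul_sum]
  congr 1
  · ring
  · refine Finset.sum_congr rfl fun τ _ => ?_
    rw [map_mul, ofXQ_rename_inr]
    ring

end Deformation

end QSchubert

theorem corollaryc2p4 (n : ℕ) :
    (∀ f : QSchubert.PS n, ∃! g : QSchubert.PS n, QSchubert.IsProj f g) ∧
    (∀ u w : Equiv.Perm (Fin n),
      ∃! c : Equiv.Perm (Fin n) → MvPolynomial (Fin (n - 1)) ℤ,
        QSchubert.IsStructConst u w c) ∧
    (∀ u w : Equiv.Perm (Fin n),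
      QSchubert.dt u (QSchubert.tSchubert w) =
        ∑ τ : Equiv.Perm (Fin n),
          QSchubert.ofQ n (QSchubert.structConst u w τ) * QSchubert.tSchubert τ) ∧
    (∀ u w : Equiv.Perm (Fin n),
      QSchubert.dt u (QSchubert.dt w (QSchubert.kernel n)) -
        ∑ τ : Equiv.Perm (Fin n),
          QSchubert.ofQ n (QSchubert.structConst u w τ) *
            QSchubert.dt τ (QSchubert.kernel n) = 0) := by
  refine ⟨QSchubert.existsUnique_isProj, QSchubert.existsUnique_isStructConst,
    QSchubert.dt_tSchubert, fun u w => ?_⟩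
  -- Since ∂K/∂t_w = S_w^t for every w, the second equation becomes the first.
  simp only [QSchubert.dt_kernel, ← QSchubert.tSchubert_eq]
  rw [QSchubert.dt_tSchubert, sub_self]
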